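/- Let $\alpha\in(\tfrac12,1]$ and let $\gamma:[0,\infty)\to\mathbb R^3$ be Hölder continuous with exponent $\alpha$, i.e. for every $T>0$ there is $K(T)$ with $|\gamma(t)-\gamma(s)|\le K(T)|t-s|^\alpha$ for all $s,t\in[0,T]$. Let $\Gamma=\{(\gamma(t),t):t>0\}\subset\mathbb R^3\times(0,\infty)$. Then there exists a function $u(x,t)$, $x\in\mathbb R^3$, $t\ge 0$, which solves $$\partial_t u-\Delta u=\delta_{\gamma(t)}\ \text{ in }\mathbb R^3\times(0,\infty),\qquad u|_{t=0}=0,$$ in the following two senses: (a) for every $t\ge0$, $u(\cdot,t)$ is a locally integrable function defining a tempered distribution whose Fourier transform (normalized by $\widehat\varphi(\xi)=\int e^{ix\cdot\xi}\varphi(x)\,dx$) is $$\widehat u(\xi,t)=\int_0^t e^{-(t-\tau)|\xi|^2}e^{i\gamma(\tau)\cdot\xi}\,d\tau ;$$ moreover $\sup_{t\ge0}\operatorname{ess\,sup}_{\xi}|\xi|^2|\widehat u(\xi,t)|<\infty$, and $t\mapsto\int u(x,t)\varphi(x)\,dx$ is continuous on $[0,\infty)$ for every Schwartz function $\varphi$;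 (b) $u$ is locally integrable on $\mathbb R^3\times[0,\infty)$ and $\int_0^\infty\!\int_{\mathbb R^3}u\,(-\partial_t\varphi-\Delta\varphi)\,dx\,dt=\int_0^\infty\varphi(\gamma(t),t)\,dt$ for all real $\varphi\in C_c^\infty(\mathbb R^3\times\mathbb R)$; and such that (i) $u\in C^\infty\big((\mathbb R^3\times(0,\infty))\setminus\Gamma\big)$; (ii) $\partial_tu=\Delta u$ at every point of $(\mathbb R^3\times(0,\infty))\setminus\Gamma$; (iii) $u(x,t)=\omega_0(x,t)+\dfrac{1}{4\pi|x-\gamma(t)|}$ on $(\mathbb R^3\times(0,\infty))\setminus\Gamma$, where for every $q\in\big(3,\tfrac{3}{2-2\alpha}\big)$ (that is, $q\in(3,\infty)$ if $\alpha=1$) and every $T>0$ there is a constant $C>0$ (depending on $q,\alpha,T$ and on the given curve $\gamma$) such that $\omega_0(\cdot,t)\in L^q(\mathbb R^3)$ and $$\|\omega_0(\cdot,t)\|_{L^q(\mathbb R^3)}\le C\,t^{\frac12\left(\frac3q-1\right)}\qquad\text{for all }t\in(0,T].$$ -/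

import Mathlib

open Set MeasureTheory InnerProductSpace
open scoped ENNReal ContDiff SchwartzMap Laplacian

noncomputable section

/-- Euclidean three-space. -/
abbrev R3 : Type := EuclideanSpace ℝ (Fin 3)

/-- `γ : [0,∞) → ℝ³` is Hölder continuous with exponent `α`, locally uniformly in time: for every
`T > 0` there is a Hölder constant on `[0,T]`. Values of `γ` at negative times play no role. -/
def IsHolderCurve (α : ℝ) (γ : ℝ → R3) : Prop :=
  ∀ T : ℝ, 0 < T → ∃ K : ℝ, ∀ s ∈ Icc 0 T, ∀ t ∈ Icc 0 T, ‖γ t - γ s‖ ≤ K * |t - s| ^ α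

/-- The set `(ℝ³ × (0,∞)) \ Γ`, where `Γ = {(γ(t),t) : t > 0}`. -/
def offCurve (γ : ℝ → R3) : Set (R3 × ℝ) :=
  {p | 0 < p.2} \ {p | ∃ t : ℝ, 0 < t ∧ p = (γ t, t)}

/-- The Fourier transform `ξ ↦ ∫ e^{i x·ξ} φ(x) dx` of a Schwartz function, in the normalization
for which the Dirac measure at `a` has Fourier transform `e^{i a·ξ}`. -/
def fourierInt (φ : 𝓢(R3, ℂ)) (ξ : R3) : ℂ :=
  ∫ x : R3, Complex.exp (Complex.I * ((inner ℝ x ξ : ℝ) : ℂ)) * φ x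

/-- The locally integrable function `f` defines a tempered distribution (it is integrable against
every Schwartz function) and its Fourier transform, in the sense of tempered distributions, is the
locally integrable function `g`: `⟨f, φ̂⟩ = ⟨g, φ⟩` for all Schwartz functions `φ`. -/
structure HasTemperedFourier (f g : R3 → ℂ) : Prop where
  locallyIntegrable_left : LocallyIntegrable f volume
  locallyIntegrable_right : LocallyIntegrable g volume
  integrable_left : ∀ φ : 𝓢(R3, ℂ), Integrable (fun x => f x * φ x) volume
  integrable_right : ∀ φ : 𝓢(R3, ℂ), Integrable (fun ξ => g ξ * φ ξ) volume
  pairing : ∀ φ : 𝓢(R3, ℂ), ∫ x, f x * fourierInt φ x = ∫ ξ, g ξ * φ ξ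

/-- The `PM^a` norm of a tempered distribution with Fourier transform `g`:
`ess sup |ξ|^a |g(ξ)|`. -/
def pmNorm (a : ℝ) (g : R3 → ℂ) : ℝ≥0∞ :=
  eLpNorm (fun ξ : R3 => ((‖ξ‖ ^ a : ℝ) : ℂ) * g ξ) ∞ volume

/-- The solution, with zero initial value, of `∂ₜ û + |ξ|² û = e^{i γ(t)·ξ}`, that is
`∫₀ᵗ e^{-(t-τ)|ξ|²} e^{i γ(τ)·ξ} dτ`. -/
def duhamelFourier (γ : ℝ → R3) (t : ℝ) (ξ : R3) : ℂ :=
  ∫ τ in (0 : ℝ)..t, Complex.exp ((-((t - τ) * ‖ξ‖ ^ 2) : ℝ) : ℂ) *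
    Complex.exp (Complex.I * ((inner ℝ (γ τ) ξ : ℝ) : ℂ))

/-- `u` is the solution of `∂ₜ u - Δ u = δ_{γ(t)}`, `u(0) = 0`, in the class
`C_w([0,∞); PM²)`: a bounded, weakly continuous curve in `PM²` that satisfies Duhamel's formula in
the Fourier variables at every time `t ≥ 0`. -/
structure IsMildSolution (γ : ℝ → R3) (u : R3 → ℝ → ℝ) : Prop where
  fourier : ∀ t : ℝ, 0 ≤ t →
    HasTemperedFourier (fun x => ((u x t : ℝ) : ℂ)) (duhamelFourier γ t)
  bounded : ∃ M : ℝ, ∀ t : ℝ, 0 ≤ t → pmNorm 2 (duhamelFourier γ t) ≤ ENNReal.ofReal M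
  weaklyContinuous : ∀ φ : 𝓢(R3, ℂ),
    ContinuousOn (fun t : ℝ => ∫ x, ((u x t : ℝ) : ℂ) * φ x) (Ici 0)

/-- `u` is a distributional solution of `∂ₜ u - Δ u = δ_{γ(t)}` in `ℝ³ × (0,∞)` with `u(0) = 0`.
The test functions need not vanish at `t = 0`, which encodes the zero initial datum. -/
structure IsDistributionalSolution (γ : ℝ → R3) (u : R3 → ℝ → ℝ) : Prop where
  locallyIntegrable :
    LocallyIntegrableOn (fun p : R3 × ℝ => u p.1 p.2) {p : R3 × ℝ | 0 ≤ p.2} volume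
  weak : ∀ φ : R3 × ℝ → ℝ, ContDiff ℝ ∞ φ → HasCompactSupport φ →
    ∫ p in {p : R3 × ℝ | 0 < p.2},
        u p.1 p.2 * (-deriv (fun s => φ (p.1, s)) p.2 - Δ (fun y => φ (y, p.2)) p.1)
      = ∫ t in Ioi (0 : ℝ), φ (γ t, t)

end

/-!
The solution is the heat potential `u(x,t) = ∫_0^t G(x-γ(τ), t-τ) dτ`, where `G` is the heat kernel
of `ℝ³`, extended by zero to nonpositive times.

*Weak formulations.* Since `G(·,s)` has mass one, `u(·,t)` is integrable on `ℝ³` and `u` is integrable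
on strips `ℝ³ × [0,T]`, so that Fubini's theorem reduces both weak formulations to a single kernel.
The Fourier formula is then the Fourier transform of the Gaussian. The distributional equation says
that `G` is a fundamental solution; after the parabolic rescaling `y = √s z` this is the fundamental
theorem of calculus for `s ↦ ∫ G(z,1) φ(a+√s z, τ+s) dz`, which is continuous up to `s = 0` and whose
derivative is computed by Gaussian integration by parts (`hasDerivAt_gaussAverage`). The same
rescaling gives weak continuity in time (`continuous_gaussAverage`).

*Regularity.* `G` is smooth on space-time off the origin (`contDiffAt_heatKernel`). Near a point off
the curve, only the values of `G` in a compact annulus around the origin enter, so `G` may be cut off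
to a smooth compactly supported function, and `u` is locally the convolution of that function with a
finite measure carried by the curve (`exists_heatPotential_eventuallyEq`). Smoothness and the heat
equation pass to the convolution.

*Remainder.* Since `1/(4π|x|) = ∫_0^∞ G(x,s) ds`, the remainder is
`∫_0^t (G(x-γ(τ),t-τ) - G(x-γ(t),t-τ)) dτ - ∫_t^∞ G(x-γ(t),s) ds`. The difference of kernels is at
most `C s^{-1/2} |γ(τ)-γ(t)| ≤ C s^{α-1/2}`, `s = t-τ`, times heat kernels at time `2s`
(`abs_heatKernel_sub_le`). As `‖G(·,s)‖_q` is a multiple of `s^{-(3/2)(1-1/q)}`, Minkowski's integral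
inequality (`eLpNorm_lintegral_le`) reduces the estimate to integrals of powers of time. The tail
converges because `q > 3` and gives `t^{(3/q-1)/2}`; the first term converges because
`q (2 - 2α) < 3` and gives `t^{α-1/2} t^{(3/q-1)/2}`, which is no larger up to a factor `T^{α-1/2}`.
-/

noncomputable section

/-! ### The heat kernel -/

/-- The heat kernel `(4πs)^{-3/2} e^{-|y|²/(4s)}` of `ℝ³` at the space-time point `(y, s)`, extended
by zero to `s ≤ 0`. With this extension it is smooth on `ℝ³ × ℝ` away from the origin. -/
def heatKernel (p : R3 × ℝ) : ℝ :=
  if 0 < p.2 then (4 * Real.pi * p.2) ^ (-(3 / 2) : ℝ) * Real.exp (-‖p.1‖ ^ 2 / (4 * p.2)) else 0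

lemma heatKernel_of_pos {y : R3} {s : ℝ} (hs : 0 < s) :
    heatKernel (y, s) = (4 * Real.pi * s) ^ (-(3 / 2) : ℝ) * Real.exp (-‖y‖ ^ 2 / (4 * s)) :=
  if_pos hs

lemma heatKernel_of_nonpos {y : R3} {s : ℝ} (hs : s ≤ 0) : heatKernel (y, s) = 0 :=
  if_neg hs.not_gt

lemma heatKernel_nonneg (p : R3 × ℝ) : 0 ≤ heatKernel p := by
  unfold heatKernel
  split_ifs <;> positivity

lemma measurable_heatKernel : Measurable heatKernel := by
  unfold heatKernel
  exact Measurable.ite (measurableSet_lt measurable_const measurable_snd) (by fun_prop)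
    measurable_const

lemma integral_exp_neg_mul_norm_sq {b : ℝ} (hb : 0 < b) :
    ∫ y : R3, Real.exp (-b * ‖y‖ ^ 2) = (Real.pi / b) ^ (3 / 2 : ℝ) := by
  have := GaussianFourier.integral_rexp_neg_mul_sq_norm (V := R3) hb
  simpa using this

lemma integrable_exp_neg_mul_norm_sq {b : ℝ} (hb : 0 < b) :
    Integrable (fun y : R3 => Real.exp (-b * ‖y‖ ^ 2)) := by
  refine Integrable.of_integral_ne_zero ?_
  rw [integral_exp_neg_mul_norm_sq hb]
  positivity

lemma neg_norm_sq_div (y : R3) (s : ℝ) : -‖y‖ ^ 2 / (4 * s) = -(1 / (4 * s)) * ‖y‖ ^ 2 := by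
  ring

lemma integrable_heatKernel (s : ℝ) : Integrable (fun y : R3 => heatKernel (y, s)) := by
  rcases le_or_gt s 0 with hs | hs
  · simp [heatKernel_of_nonpos hs]
  · simp only [heatKernel_of_pos hs, neg_norm_sq_div]
    exact (integrable_exp_neg_mul_norm_sq (by positivity)).const_mul _

lemma integral_heatKernel {s : ℝ} (hs : 0 < s) : ∫ y : R3, heatKernel (y, s) = 1 := by
  simp only [heatKernel_of_pos hs, neg_norm_sq_div]
  rw [integral_const_mul, integral_exp_neg_mul_norm_sq (by positivity),
    show Real.pi / (1 / (4 * s)) = 4 * Real.pi * s by field_simp,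
    ← Real.rpow_add (by positivity)]
  norm_num

lemma integral_heatKernel_mul_cexp {s : ℝ} (hs : 0 < s) (ξ : R3) :
    ∫ y : R3, (heatKernel (y, s) : ℂ) * Complex.exp (Complex.I * ((inner ℝ y ξ : ℝ) : ℂ)) =
      Complex.exp ((-(s * ‖ξ‖ ^ 2) : ℝ) : ℂ) := by
  have hb : 0 < ((1 / (4 * s) : ℝ) : ℂ).re := by
    rw [Complex.ofReal_re]; positivity
  have h := GaussianFourier.integral_cexp_neg_mul_sq_norm_add hb Complex.I ξ
  have e : ∀ y : R3, (heatKernel (y, s) : ℂ) *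
      Complex.exp (Complex.I * ((inner ℝ y ξ : ℝ) : ℂ)) =
      (((4 * Real.pi * s) ^ (-(3 / 2) : ℝ) : ℝ) : ℂ) *
        Complex.exp (-((1 / (4 * s) : ℝ) : ℂ) * (‖y‖ : ℂ) ^ 2 +
          Complex.I * ((inner ℝ ξ y : ℝ) : ℂ)) := by
    intro y
    rw [heatKernel_of_pos hs, neg_norm_sq_div, Complex.exp_add, real_inner_comm]
    push_cast
    ring
  simp_rw [e]
  rw [integral_const_mul, h]
  have e2 : ((Real.pi : ℂ) / ((1 / (4 * s) : ℝ) : ℂ)) ^ ((Module.finrank ℝ R3 : ℂ) / 2) =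
      (((4 * Real.pi * s) ^ (3 / 2 : ℝ) : ℝ) : ℂ) := by
    rw [Complex.ofReal_cpow (by positivity)]
    congr 1
    · push_cast
      have : (s : ℂ) ≠ 0 := by exact_mod_cast hs.ne'
      field_simp
    · simp
  rw [e2, ← mul_assoc, ← Complex.ofReal_mul, ← Real.rpow_add (by positivity)]
  have hs' : (s : ℂ) ≠ 0 := by exact_mod_cast hs.ne'
  norm_num
  congr 1
  field_simp

/-- Parabolic rescaling: integration against the heat kernel at time `s` is integration against the
heat kernel at time `1` at the spatial scale `√s`. -/
lemma integral_heatKernel_smul {E : Type*} [NormedAddCommGroup E] [NormedSpace ℝ E] {s : ℝ}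
    (hs : 0 < s) (f : R3 → E) :
    ∫ y : R3, heatKernel (y, s) • f y = ∫ z : R3, heatKernel (z, 1) • f (√s • z) := by
  have h := Measure.integral_comp_smul (volume : Measure R3)
    (fun y => heatKernel (y, s) • f y) (√s)
  have hq : 0 < √s := Real.sqrt_pos.2 hs
  have e : ∀ z : R3, heatKernel (√s • z, s) = (√s ^ 3)⁻¹ * heatKernel (z, 1) := by
    intro z
    rw [heatKernel_of_pos hs, heatKernel_of_pos one_pos, norm_smul, mul_one,
      Real.mul_rpow (by positivity) hs.le]
    have : s ^ (-(3 / 2) : ℝ) = (√s ^ 3)⁻¹ := by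
      rw [Real.sqrt_eq_rpow, ← Real.rpow_natCast, ← Real.rpow_mul hs.le, ← Real.rpow_neg hs.le]
      norm_num
    rw [this, mul_pow, Real.norm_of_nonneg hq.le, Real.sq_sqrt hs.le]
    have : -(s * ‖z‖ ^ 2) / (4 * s) = -‖z‖ ^ 2 / (4 * 1) := by field_simp
    rw [this]; ring_nf
  simp only [e, mul_smul] at h
  rw [integral_smul] at h
  have hne : (√s ^ 3)⁻¹ ≠ 0 := by positivity
  have hf : Module.finrank ℝ R3 = 3 := by simp
  rw [hf, abs_of_nonneg (by positivity)] at h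
  exact (smul_right_injective E hne h).symm

/-- The `L^q` norm of the heat kernel at time `s` is a constant times `s^{-(3/2)(1-1/q)}`. -/
lemma exists_lintegral_heatKernel_rpow {q : ℝ} (hq : 0 < q) :
    ∃ c : ℝ, 0 < c ∧ ∀ s : ℝ, 0 < s →
      ∫⁻ y : R3, ENNReal.ofReal (heatKernel (y, s)) ^ q =
        ENNReal.ofReal (c * s ^ (-(3 / 2) * (1 - 1 / q))) ^ q := by
  refine ⟨((4 * Real.pi) ^ (-(3 / 2) * q) * (4 * Real.pi / q) ^ (3 / 2 : ℝ)) ^ (1 / q),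
    by positivity, fun s hs => ?_⟩
  have hb : 0 < q / (4 * s) := by positivity
  have e : ∀ y : R3, ENNReal.ofReal (heatKernel (y, s)) ^ q =
      ENNReal.ofReal ((4 * Real.pi * s) ^ (-(3 / 2) * q) * Real.exp (-(q / (4 * s)) * ‖y‖ ^ 2)) := by
    intro y
    rw [ENNReal.ofReal_rpow_of_nonneg (heatKernel_nonneg _) hq.le, heatKernel_of_pos hs,
      Real.mul_rpow (by positivity) (by positivity), ← Real.rpow_mul (by positivity),
      ← Real.exp_mul]
    congr 3
    ring
  simp_rw [e]
  have hR : (((4 * Real.pi) ^ (-(3 / 2) * q) * (4 * Real.pi / q) ^ (3 / 2 : ℝ)) ^ (1 / q) *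
      s ^ (-(3 / 2) * (1 - 1 / q))) ^ q =
      (4 * Real.pi) ^ (-(3 / 2) * q) * (4 * Real.pi / q) ^ (3 / 2 : ℝ) *
        (s ^ (-(3 / 2) * q) * s ^ (3 / 2 : ℝ)) := by
    rw [Real.mul_rpow (by positivity) (by positivity), ← Real.rpow_mul (by positivity),
      ← Real.rpow_mul hs.le, one_div_mul_cancel hq.ne', Real.rpow_one, ← Real.rpow_add hs]
    congr 2
    field_simp
    ring
  rw [← ofReal_integral_eq_lintegral_ofReal
    ((integrable_exp_neg_mul_norm_sq hb).const_mul _)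
    (Filter.Eventually.of_forall fun y => by positivity), integral_const_mul,
    integral_exp_neg_mul_norm_sq hb, ENNReal.ofReal_rpow_of_nonneg (by positivity) hq.le, hR,
    Real.mul_rpow (by positivity) hs.le,
    show Real.pi / (q / (4 * s)) = 4 * Real.pi / q * s by field_simp,
    Real.mul_rpow (by positivity) hs.le]
  ring_nf

/-- The substitution `s = v^{-2}` turns the heat kernel, as a function of time, into a Gaussian. -/
lemma heatKernel_comp_rpow {x : R3} {v : ℝ} (hv : 0 < v) :
    (|(-2 : ℝ)| * v ^ ((-2 : ℝ) - 1)) • heatKernel (x, v ^ (-2 : ℝ)) =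
      2 * (4 * Real.pi) ^ (-(3 / 2) : ℝ) * Real.exp (-(‖x‖ ^ 2 / 4) * v ^ 2) := by
  rw [heatKernel_of_pos (by positivity), Real.mul_rpow (by positivity) (by positivity),
    ← Real.rpow_mul hv.le, smul_eq_mul]
  have h1 : v ^ ((-2 : ℝ) - 1) * v ^ ((-2 : ℝ) * -(3 / 2)) = 1 := by
    rw [← Real.rpow_add hv]; norm_num
  have h2 : v ^ (-2 : ℝ) = (v ^ 2)⁻¹ := by
    rw [Real.rpow_neg hv.le]; norm_cast
  have h3 : -‖x‖ ^ 2 / (4 * v ^ (-2 : ℝ)) = -(‖x‖ ^ 2 / 4) * v ^ 2 := by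
    rw [h2]; field_simp
  rw [h3, abs_of_neg (by norm_num)]
  linear_combination (2 * (4 * Real.pi) ^ (-(3 / 2) : ℝ) *
    Real.exp (-(‖x‖ ^ 2 / 4) * v ^ 2)) * h1

lemma integrableOn_heatKernel_time {x : R3} (hx : x ≠ 0) :
    IntegrableOn (fun s => heatKernel (x, s)) (Ioi 0) := by
  have hx' : 0 < ‖x‖ := norm_pos_iff.2 hx
  rw [← integrableOn_Ioi_comp_rpow_iff _ (show (-2 : ℝ) ≠ 0 by norm_num)]
  refine (integrableOn_congr_fun (fun v hv => heatKernel_comp_rpow hv) measurableSet_Ioi).2 ?_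
  exact ((integrable_exp_neg_mul_sq (by positivity)).const_mul _).integrableOn

/-- The integral of the heat kernel over all times is the Newtonian potential. -/
lemma integral_heatKernel_time {x : R3} (hx : x ≠ 0) :
    ∫ s in Ioi (0 : ℝ), heatKernel (x, s) = 1 / (4 * Real.pi * ‖x‖) := by
  have hx' : 0 < ‖x‖ := norm_pos_iff.2 hx
  rw [← integral_comp_rpow_Ioi _ (show (-2 : ℝ) ≠ 0 by norm_num),
    setIntegral_congr_fun measurableSet_Ioi (fun v hv => heatKernel_comp_rpow hv),
    integral_const_mul, integral_gaussian_Ioi,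
    show Real.pi / (‖x‖ ^ 2 / 4) = (4 * Real.pi) / ‖x‖ ^ 2 by field_simp,
    Real.sqrt_div (by positivity), Real.sqrt_sq hx'.le, Real.sqrt_eq_rpow]
  have : (4 * Real.pi) ^ (-(3 / 2) : ℝ) * (4 * Real.pi) ^ (1 / 2 : ℝ) = (4 * Real.pi)⁻¹ := by
    rw [← Real.rpow_add (by positivity), ← Real.rpow_neg_one]; norm_num
  have h4 : (0 : ℝ) < 4 * Real.pi := by positivity
  calc _ = ((4 * Real.pi) ^ (-(3 / 2) : ℝ) * (4 * Real.pi) ^ (1 / 2 : ℝ)) / ‖x‖ := by ring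
    _ = _ := by rw [this]; field_simp

/-- The radial derivative of a Gaussian is bounded by `s^{-1/2}` times the Gaussian of twice the
variance. The latter decreases in the radius, so the mean value inequality needs only its value at
the smaller endpoint. -/
lemma abs_exp_neg_sq_sub_le {s r₁ r₂ : ℝ} (hs : 0 < s) (h₁ : 0 ≤ r₁) (h₂ : 0 ≤ r₂) :
    |Real.exp (-r₁ ^ 2 / (4 * s)) - Real.exp (-r₂ ^ 2 / (4 * s))| ≤
      (√s)⁻¹ * |r₁ - r₂| *
        (Real.exp (-r₁ ^ 2 / (4 * (2 * s))) + Real.exp (-r₂ ^ 2 / (4 * (2 * s)))) := by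
  wlog h : r₁ ≤ r₂ generalizing r₁ r₂
  · rw [abs_sub_comm, abs_sub_comm r₁, add_comm (Real.exp _)]
    exact this h₂ h₁ (le_of_not_ge h)
  have hq : 0 < √s := Real.sqrt_pos.2 hs
  have hd : ∀ r ∈ Icc r₁ r₂, HasDerivWithinAt (fun r : ℝ => Real.exp (-r ^ 2 / (4 * s)))
      (Real.exp (-r ^ 2 / (4 * s)) * (-(2 * r) / (4 * s))) (Icc r₁ r₂) r := by
    intro r _
    refine HasDerivAt.hasDerivWithinAt ?_
    simpa using (((hasDerivAt_pow 2 r).neg).div_const (4 * s)).exp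
  have hb : ∀ r ∈ Icc r₁ r₂, ‖Real.exp (-r ^ 2 / (4 * s)) * (-(2 * r) / (4 * s))‖ ≤
      (√s)⁻¹ * Real.exp (-r₁ ^ 2 / (4 * (2 * s))) := by
    intro r hr
    have hr0 : 0 ≤ r := h₁.trans hr.1
    have e1 : ‖Real.exp (-r ^ 2 / (4 * s)) * (-(2 * r) / (4 * s))‖ =
        (√s)⁻¹ * Real.exp (-r ^ 2 / (4 * (2 * s))) *
          ((r / (2 * √s)) * Real.exp (-r ^ 2 / (4 * (2 * s)))) := by
      have : Real.exp (-r ^ 2 / (4 * s)) =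
          Real.exp (-r ^ 2 / (4 * (2 * s))) * Real.exp (-r ^ 2 / (4 * (2 * s))) := by
        rw [← Real.exp_add]; congr 1; field_simp; norm_num
      -- One of the two half-strength Gaussians is spent on absorbing the linear factor `r`.
      rw [norm_mul, Real.norm_of_nonneg (Real.exp_pos _).le, this, neg_div (4 * s), norm_neg,
        Real.norm_of_nonneg (r := 2 * r / (4 * s)) (by positivity)]
      have : 2 * r / (4 * s) = (√s)⁻¹ * (r / (2 * √s)) := by
        nth_rewrite 1 [← Real.sq_sqrt hs.le]
        field_simp; ring
      rw [this]; ring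
    have e2 : (r / (2 * √s)) * Real.exp (-r ^ 2 / (4 * (2 * s))) ≤ 1 := by
      set a := r / (2 * √s) with ha
      have ha2 : -r ^ 2 / (4 * (2 * s)) = -(a ^ 2 / 2) := by
        rw [ha, div_pow, mul_pow, Real.sq_sqrt hs.le]; field_simp; norm_num
      rw [ha2, Real.exp_neg, ← div_eq_mul_inv, div_le_one (Real.exp_pos _)]
      nlinarith [Real.add_one_le_exp (a ^ 2 / 2), sq_nonneg (a - 1)]
    have e3 : Real.exp (-r ^ 2 / (4 * (2 * s))) ≤ Real.exp (-r₁ ^ 2 / (4 * (2 * s))) := by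
      have := hr.1
      gcongr
    rw [e1]
    calc _ ≤ (√s)⁻¹ * Real.exp (-r₁ ^ 2 / (4 * (2 * s))) * 1 := by gcongr
      _ = _ := mul_one _
  have := (convex_Icc r₁ r₂).norm_image_sub_le_of_norm_hasDerivWithin_le hd hb
    (right_mem_Icc.2 h) (left_mem_Icc.2 h)
  rw [Real.norm_eq_abs, Real.norm_eq_abs] at this
  refine this.trans ?_
  rw [mul_right_comm, mul_add]
  exact le_add_of_nonneg_right (by positivity)

/-- Lipschitz estimate for the heat kernel that retains Gaussian decay at both points; the price is
a doubling of the time. -/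
lemma abs_heatKernel_sub_le {s : ℝ} (hs : 0 < s) (y z : R3) :
    |heatKernel (y, s) - heatKernel (z, s)| ≤
      2 ^ (3 / 2 : ℝ) * (s ^ (-(1 / 2) : ℝ) * ‖y - z‖) *
        (heatKernel (y, 2 * s) + heatKernel (z, 2 * s)) := by
  have hq : (√s)⁻¹ = s ^ (-(1 / 2) : ℝ) := by rw [Real.sqrt_eq_rpow, Real.rpow_neg hs.le]
  have h := abs_exp_neg_sq_sub_le hs (norm_nonneg y) (norm_nonneg z)
  rw [hq] at h
  have h' := abs_norm_sub_norm_le y z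
  rw [heatKernel_of_pos hs, heatKernel_of_pos hs, heatKernel_of_pos (by positivity),
    heatKernel_of_pos (by positivity), ← mul_sub, abs_mul, abs_of_nonneg (by positivity),
    show 4 * Real.pi * (2 * s) = 2 * (4 * Real.pi * s) by ring,
    Real.mul_rpow (x := 2) (by norm_num) (by positivity)]
  have h2 : (2 : ℝ) ^ (3 / 2 : ℝ) * 2 ^ (-(3 / 2) : ℝ) = 1 := by
    rw [← Real.rpow_add (by norm_num)]; norm_num
  calc _ ≤ (4 * Real.pi * s) ^ (-(3 / 2) : ℝ) * (s ^ (-(1 / 2) : ℝ) * ‖y - z‖ *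
        (Real.exp (-‖y‖ ^ 2 / (4 * (2 * s))) + Real.exp (-‖z‖ ^ 2 / (4 * (2 * s))))) := by
        gcongr
        exact h.trans (by gcongr)
    _ = _ := by
      linear_combination -((4 * Real.pi * s) ^ (-(3 / 2) : ℝ) * (s ^ (-(1 / 2) : ℝ) * ‖y - z‖ *
        (Real.exp (-‖y‖ ^ 2 / (4 * (2 * s))) + Real.exp (-‖z‖ ^ 2 / (4 * (2 * s)))))) * h2

/-! ### Smoothness of the heat kernel -/

section Smooth
open Polynomial Filter
open scoped Topology

/-- The function `P(1/x) √x e^{-1/x}` on `(0,∞)`, extended by zero to `(-∞,0]`. The factor `√x`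
accounts for the half-integral power of time in the heat kernel in odd dimension. -/
def sqrtGlue (P : ℝ[X]) (x : ℝ) : ℝ := P.eval x⁻¹ * expNegInvGlue x * √x

/-- The class of functions `sqrtGlue P` is closed under differentiation, which makes each of its
members smooth. -/
lemma hasDerivAt_sqrtGlue (P : ℝ[X]) (x : ℝ) :
    HasDerivAt (sqrtGlue P)
      (sqrtGlue (X ^ 2 * (P - derivative (R := ℝ) P) + C (1 / 2) * X * P) x) x := by
  rcases lt_trichotomy x 0 with hx | rfl | hx
  · have h0 : ∀ (Q : ℝ[X]) (y : ℝ), y < 0 → sqrtGlue Q y = 0 := fun Q y hy => by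
      simp [sqrtGlue, expNegInvGlue.zero_of_nonpos hy.le]
    rw [h0 _ x hx]
    refine (hasDerivAt_const _ 0).congr_of_eventuallyEq ?_
    filter_upwards [gt_mem_nhds hx] with y hy using h0 P y hy
  · rw [show sqrtGlue _ 0 = 0 by simp [sqrtGlue], hasDerivAt_iff_tendsto_slope]
    have h := ((expNegInvGlue.tendsto_polynomial_inv_mul_zero (P * X)).mul
      (Real.continuous_sqrt.tendsto 0)).mono_left (inf_le_left : 𝓝[≠] (0 : ℝ) ≤ 𝓝 0)
    rw [zero_mul] at h
    refine h.congr fun x => ?_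
    simp [slope_def_field, sqrtGlue, div_eq_mul_inv]
    ring
  · have h1 := expNegInvGlue.hasDerivAt_polynomial_eval_inv_mul P x
    have h2 := Real.hasDerivAt_sqrt hx.ne'
    convert! h1.mul h2 using 1
    have : 1 / (2 * √x) = 1 / 2 * x⁻¹ * √x := by
      have := Real.sqrt_pos.2 hx
      nth_rewrite 2 [← Real.sq_sqrt hx.le]
      field_simp
    rw [this]
    simp [sqrtGlue]
    ring

lemma contDiff_sqrtGlue {n : ℕ∞} (P : ℝ[X]) : ContDiff ℝ n (sqrtGlue P) := by
  have hd : ∀ P, Differentiable ℝ (sqrtGlue P) :=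
    fun P x => (hasDerivAt_sqrtGlue P x).differentiableAt
  apply contDiff_all_iff_nat.2 (fun m => ?_) n
  induction m generalizing P with
  | zero => exact contDiff_zero.2 (hd P).continuous
  | succ m ihm =>
    rw [show ((m + 1 : ℕ) : WithTop ℕ∞) = m + 1 from rfl]
    refine contDiff_succ_iff_deriv.2 ⟨hd P, by simp, ?_⟩
    convert! ihm (X ^ 2 * (P - derivative (R := ℝ) P) + C (1 / 2) * X * P) using 2
    exact funext fun y => (hasDerivAt_sqrtGlue P y).deriv

lemma heatKernel_eq_sqrtGlue {y : R3} (hy : y ≠ 0) (s : ℝ) :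
    heatKernel (y, s) = Real.pi ^ (-(3 / 2) : ℝ) * (‖y‖ ^ 3)⁻¹ *
      sqrtGlue (X ^ 2) (4 * s * (‖y‖ ^ 2)⁻¹) := by
  have hy' : 0 < ‖y‖ := norm_pos_iff.2 hy
  rcases le_or_gt s 0 with hs | hs
  · rw [heatKernel_of_nonpos hs, sqrtGlue, expNegInvGlue.zero_of_nonpos, mul_zero, zero_mul,
      mul_zero]
    exact mul_nonpos_of_nonpos_of_nonneg (by linarith) (by positivity)
  · have hw : 0 < 4 * s * (‖y‖ ^ 2)⁻¹ := by positivity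
    rw [heatKernel_of_pos hs, sqrtGlue, expNegInvGlue, if_neg hw.not_ge]
    have e1 : -‖y‖ ^ 2 / (4 * s) = -(4 * s * (‖y‖ ^ 2)⁻¹)⁻¹ := by field_simp
    rw [e1]
    generalize hw' : 4 * s * (‖y‖ ^ 2)⁻¹ = w at hw
    have e2 : 4 * Real.pi * s = Real.pi * (‖y‖ ^ 2 * w) := by rw [← hw']; field_simp
    rw [e2, Real.mul_rpow (by positivity) (by positivity), Real.mul_rpow (by positivity) hw.le]
    have e3 : (‖y‖ ^ 2) ^ (-(3 / 2) : ℝ) = (‖y‖ ^ 3)⁻¹ := by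
      rw [← Real.rpow_natCast, ← Real.rpow_mul hy'.le, ← Real.rpow_natCast, ← Real.rpow_neg hy'.le]
      norm_num
    have e4 : w ^ (-(3 / 2) : ℝ) = w⁻¹ ^ 2 * √w := by
      rw [Real.sqrt_eq_rpow, inv_pow, ← Real.rpow_natCast, ← Real.rpow_neg hw.le,
        ← Real.rpow_add hw]
      norm_num
    rw [e3, e4]
    simp
    ring

/-- The heat kernel is smooth off the origin of space-time, in particular across `s = 0` at
`y ≠ 0`. -/
lemma contDiffAt_heatKernel {p : R3 × ℝ} (hp : p ≠ 0) : ContDiffAt ℝ ∞ heatKernel p := by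
  obtain ⟨y, s⟩ := p
  by_cases hy : y = 0
  · have hs : s ≠ 0 := fun hs => hp (by simp [hy, hs])
    rcases lt_or_gt_of_ne hs with hs | hs
    · refine (contDiffAt_const (c := (0 : ℝ))).congr_of_eventuallyEq ?_
      filter_upwards [(isOpen_Iio.preimage continuous_snd).mem_nhds (show (y, s).2 < 0 from hs)]
        with q hq
      exact heatKernel_of_nonpos (y := q.1) (le_of_lt hq)
    · have : ContDiffAt ℝ ∞ (fun p : R3 × ℝ => (4 * Real.pi * p.2) ^ (-(3 / 2) : ℝ) *
          Real.exp (-‖p.1‖ ^ 2 / (4 * p.2))) (y, s) := by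
        have h1 : ContDiffAt ℝ ∞ (fun p : R3 × ℝ => 4 * Real.pi * p.2) (y, s) := by fun_prop
        have h2 : ContDiffAt ℝ ∞ (fun p : R3 × ℝ => 4 * p.2) (y, s) := by fun_prop
        have h3 : ContDiffAt ℝ ∞ (fun p : R3 × ℝ => -‖p.1‖ ^ 2) (y, s) :=
          (contDiff_fst.norm_sq ℝ).neg.contDiffAt
        exact (h1.rpow_const_of_ne (by simp; positivity)).mul
          ((h3.div h2 (by simp; positivity)).exp)
      refine this.congr_of_eventuallyEq ?_
      filter_upwards [(isOpen_Ioi.preimage continuous_snd).mem_nhds (show 0 < (y, s).2 from hs)]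
        with q hq
      exact heatKernel_of_pos (y := q.1) hq
  · have hn : ContDiffAt ℝ ∞ (fun p : R3 × ℝ => ‖p.1‖) (y, s) := contDiffAt_fst.norm ℝ hy
    have hy' : ‖y‖ ≠ 0 := norm_ne_zero_iff.2 hy
    have : ContDiffAt ℝ ∞ (fun p : R3 × ℝ => Real.pi ^ (-(3 / 2) : ℝ) * (‖p.1‖ ^ 3)⁻¹ *
      sqrtGlue (X ^ 2) (4 * p.2 * (‖p.1‖ ^ 2)⁻¹)) (y, s) := by
      refine (contDiffAt_const.mul ((hn.pow 3).inv (by simpa using hy))).mul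
        ((contDiff_sqrtGlue _).contDiffAt.comp (y, s) (?_ : ContDiffAt ℝ ∞
          (fun p : R3 × ℝ => 4 * p.2 * (‖p.1‖ ^ 2)⁻¹) (y, s)))
      exact (contDiffAt_const.mul contDiffAt_snd).mul ((hn.pow 2).inv (by simpa using hy))
    refine this.congr_of_eventuallyEq ?_
    filter_upwards [(isOpen_compl_singleton.preimage continuous_fst).mem_nhds
      (show (y, s).1 ∈ ({0}ᶜ : Set R3) from hy)] with q hq
    exact heatKernel_eq_sqrtGlue (y := q.1) hq q.2

end Smooth

/-! ### The heat operator on space-time -/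

section HeatOp
open scoped Topology

/-- The standard basis of `ℝ³`. -/
abbrev stdBasis (i : Fin 3) : R3 := EuclideanSpace.basisFun (Fin 3) ℝ i

/-- The time derivative of a function on space-time, as a component of its Fréchet derivative. -/
def timeDeriv (f : R3 × ℝ → ℝ) (p : R3 × ℝ) : ℝ := fderiv ℝ f p (0, 1)

/-- The `i`-th spatial partial derivative of a function on space-time, as a component of its
Fréchet derivative. -/
def spaceDeriv (i : Fin 3) (f : R3 × ℝ → ℝ) (p : R3 × ℝ) : ℝ := fderiv ℝ f p (stdBasis i, 0)

/-- The spatial Laplacian of a function on space-time. -/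
def spaceLaplacian (f : R3 × ℝ → ℝ) (p : R3 × ℝ) : ℝ :=
  ∑ i, spaceDeriv i (spaceDeriv i f) p

lemma timeDeriv_congr {f g : R3 × ℝ → ℝ} {p : R3 × ℝ} (h : f =ᶠ[𝓝 p] g) :
    timeDeriv f p = timeDeriv g p := by
  rw [timeDeriv, h.fderiv_eq, timeDeriv]

lemma spaceDeriv_congr {i : Fin 3} {f g : R3 × ℝ → ℝ} {p : R3 × ℝ} (h : f =ᶠ[𝓝 p] g) :
    spaceDeriv i f =ᶠ[𝓝 p] spaceDeriv i g := by
  filter_upwards [h.fderiv (𝕜 := ℝ)] with q hq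
  rw [spaceDeriv, hq, spaceDeriv]

lemma spaceLaplacian_congr {f g : R3 × ℝ → ℝ} {p : R3 × ℝ} (h : f =ᶠ[𝓝 p] g) :
    spaceLaplacian f p = spaceLaplacian g p :=
  Finset.sum_congr rfl fun _ _ => (spaceDeriv_congr (spaceDeriv_congr h)).eq_of_nhds

lemma deriv_slice {f : R3 × ℝ → ℝ} {x : R3} {t : ℝ} (hf : DifferentiableAt ℝ f (x, t)) :
    deriv (fun s => f (x, s)) t = timeDeriv f (x, t) :=
  (hf.hasFDerivAt.comp_hasDerivAt t ((hasDerivAt_const t x).prodMk (hasDerivAt_id t))).deriv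

lemma fderiv_slice {f : R3 × ℝ → ℝ} {x : R3} {t : ℝ} (hf : DifferentiableAt ℝ f (x, t)) (v : R3) :
    fderiv ℝ (fun y => f (y, t)) x v = fderiv ℝ f (x, t) (v, 0) := by
  have h0 : HasFDerivAt (fun y : R3 => (y, t)) ((ContinuousLinearMap.id ℝ R3).prod 0) x :=
    (hasFDerivAt_id x).prodMk (hasFDerivAt_const t x)
  have h := HasFDerivAt.comp x (g := f) hf.hasFDerivAt h0
  have h' : fderiv ℝ (fun y => f (y, t)) x = _ := h.fderiv
  rw [h']
  simp

lemma laplacian_slice {f : R3 × ℝ → ℝ} {x : R3} {t : ℝ} (hf : ContDiffAt ℝ 2 f (x, t)) :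
    Δ (fun y => f (y, t)) x = spaceLaplacian f (x, t) := by
  have hev : ∀ᶠ y in 𝓝 x, ContDiffAt ℝ 2 f (y, t) :=
    (Continuous.prodMk_left t).continuousAt.eventually (hf.eventually (by simp))
  have hsl : ContDiffAt ℝ 2 (fun y => f (y, t)) x :=
    hf.comp x (contDiffAt_id.prodMk contDiffAt_const)
  rw [laplacian_eq_iteratedFDeriv_orthonormalBasis _ (EuclideanSpace.basisFun (Fin 3) ℝ)]
  refine Finset.sum_congr rfl fun i _ => ?_
  rw [iteratedFDeriv_two_apply]
  have h1 : DifferentiableAt ℝ (fderiv ℝ (fun y => f (y, t))) x :=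
    (hsl.fderiv_right (m := 1) (by norm_num)).differentiableAt (by norm_num)
  have h2 : DifferentiableAt ℝ (spaceDeriv i f) (x, t) := by
    have : ContDiffAt ℝ 1 (fderiv ℝ f) (x, t) := hf.fderiv_right (by norm_num)
    exact (this.differentiableAt (by norm_num)).clm_apply (differentiableAt_const _)
  have h3 : (fun y => fderiv ℝ (fun y => f (y, t)) y (stdBasis i)) =ᶠ[𝓝 x]
      fun y => spaceDeriv i f (y, t) := by
    filter_upwards [hev] with y hy
    exact fderiv_slice (hy.differentiableAt (by norm_num)) _
  have h4 := h3.fderiv_eq (𝕜 := ℝ)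
  rw [spaceDeriv, ← fderiv_slice h2, ← h4, fderiv_clm_apply h1 (differentiableAt_const _)]
  simp

lemma fderiv_heatKernel {y : R3} {s : ℝ} (hs : 0 < s) (v : R3 × ℝ) :
    fderiv ℝ heatKernel (y, s) v = heatKernel (y, s) *
      (-(inner ℝ y v.1) / (2 * s) + v.2 * (‖y‖ ^ 2 / (4 * s ^ 2) - 3 / (2 * s))) := by
  have hd : DifferentiableAt ℝ heatKernel (y, s) :=
    (contDiffAt_heatKernel (by simp [hs.ne'])).differentiableAt (by simp)
  have hl := (hd.hasFDerivAt.hasLineDerivAt v)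
  have hσ : HasDerivAt (fun h : ℝ => s + h * v.2) v.2 0 := by
    simpa using ((hasDerivAt_id (0 : ℝ)).mul_const v.2).const_add s
  have hy : HasDerivAt (fun h : ℝ => y + h • v.1) v.1 0 := by
    simpa using ((hasDerivAt_id (0 : ℝ)).smul_const v.1).const_add y
  have h1 := (hσ.const_mul (4 * Real.pi)).rpow_const (p := -(3 / 2))
    (Or.inl (by simp; positivity))
  have h2 := (hy.norm_sq.neg.div (hσ.const_mul 4) (by simp; positivity)).exp
  have h3 := h1.mul h2
  have hl' : HasDerivAt (fun h : ℝ => heatKernel ((y, s) + h • v)) (fderiv ℝ heatKernel (y, s) v) 0 :=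
    hl
  have hev : (fun h : ℝ => heatKernel ((y, s) + h • v)) =ᶠ[𝓝 0]
      fun h => (4 * Real.pi * (s + h * v.2)) ^ (-(3 / 2) : ℝ) *
        Real.exp (-‖y + h • v.1‖ ^ 2 / (4 * (s + h * v.2))) := by
    have : ∀ᶠ h in 𝓝 (0 : ℝ), 0 < s + h * v.2 :=
      hσ.continuousAt.eventually (lt_mem_nhds (by simpa using hs))
    filter_upwards [this] with h hh
    exact heatKernel_of_pos (y := y + h • v.1) hh
  have := (h3.congr_of_eventuallyEq hev).unique hl'
  rw [← this, heatKernel_of_pos hs]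
  have hp : (4 * Real.pi * s) ^ (-(3 / 2) - 1 : ℝ) =
      (4 * Real.pi * s) ^ (-(3 / 2) : ℝ) * (4 * Real.pi * s)⁻¹ := by
    rw [Real.rpow_sub_one (by positivity), div_eq_mul_inv]
  simp only [zero_mul, add_zero, zero_smul, Pi.neg_apply, Pi.div_apply, hp]
  field_simp
  ring

lemma spaceDeriv_spaceDeriv_heatKernel {y : R3} {s : ℝ} (hs : 0 < s) (i : Fin 3) :
    spaceDeriv i (spaceDeriv i heatKernel) (y, s) = heatKernel (y, s) *
      ((inner ℝ y (stdBasis i)) ^ 2 / (4 * s ^ 2) - 1 / (2 * s)) := by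
  have hev : spaceDeriv i heatKernel =ᶠ[𝓝 (y, s)]
      fun q => heatKernel q * (-(inner ℝ q.1 (stdBasis i)) * (2 * q.2)⁻¹) := by
    filter_upwards [(isOpen_Ioi.preimage continuous_snd).mem_nhds (show 0 < (y, s).2 from hs)]
      with q hq
    have := fderiv_heatKernel (y := q.1) hq (stdBasis i, 0)
    rw [spaceDeriv, this]
    simp [div_eq_mul_inv]
  have hd : DifferentiableAt ℝ heatKernel (y, s) :=
    (contDiffAt_heatKernel (by simp [hs.ne'])).differentiableAt (by simp)
  have hi : DifferentiableAt ℝ (fun q : R3 × ℝ => -(inner ℝ q.1 (stdBasis i))) (y, s) :=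
    (differentiableAt_fst.inner ℝ (differentiableAt_const _)).neg
  have hj : DifferentiableAt ℝ (fun q : R3 × ℝ => (2 * q.2)⁻¹) (y, s) :=
    DifferentiableAt.inv (by fun_prop) (by simp; positivity)
  have hg : DifferentiableAt ℝ (fun q : R3 × ℝ =>
      -(inner ℝ q.1 (stdBasis i)) * (2 * q.2)⁻¹) (y, s) := hi.mul hj
  have hl : HasDerivAt (fun h : ℝ => -(inner ℝ (y + h • stdBasis i) (stdBasis i)) *
      (2 * (s + h * 0))⁻¹) (-1 * (2 * s)⁻¹) 0 := by
    have hb : inner ℝ (stdBasis i) (stdBasis i) = 1 := by simp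
    simp only [inner_add_left, inner_smul_left, mul_zero, add_zero, hb]
    simpa using (((hasDerivAt_id (0 : ℝ)).const_add (inner ℝ y (stdBasis i))).neg).mul_const
      ((2 * s)⁻¹)
  have hl' : HasDerivAt (fun h : ℝ => -(inner ℝ (y + h • stdBasis i) (stdBasis i)) *
      (2 * (s + h * 0))⁻¹) (fderiv ℝ (fun q : R3 × ℝ =>
        -(inner ℝ q.1 (stdBasis i)) * (2 * q.2)⁻¹) (y, s) (stdBasis i, 0)) 0 :=
    hg.hasFDerivAt.hasLineDerivAt (stdBasis i, (0 : ℝ))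
  have := hl'.unique hl
  rw [spaceDeriv, hev.fderiv_eq, fderiv_fun_mul hd hg]
  simp only [add_apply, smul_apply, smul_eq_mul]
  rw [this, fderiv_heatKernel hs]
  simp only [zero_mul, add_zero]
  field_simp
  ring

/-- The heat kernel solves the heat equation at every nonzero time. -/
lemma timeDeriv_heatKernel {p : R3 × ℝ} (hp : p.2 ≠ 0) :
    timeDeriv heatKernel p = spaceLaplacian heatKernel p := by
  obtain ⟨y, s⟩ := p
  rcases lt_or_gt_of_ne hp with hs | hs
  · have h0 : heatKernel =ᶠ[𝓝 (y, s)] fun _ => 0 := by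
      filter_upwards [(isOpen_Iio.preimage continuous_snd).mem_nhds (show (y, s).2 < 0 from hs)]
        with q hq
      exact heatKernel_of_nonpos (y := q.1) (le_of_lt hq)
    rw [timeDeriv_congr h0, spaceLaplacian_congr h0]
    have : ∀ i, spaceDeriv i (fun _ => 0) = fun _ => 0 := fun i => by ext; simp [spaceDeriv]
    simp [timeDeriv, spaceLaplacian, this]
  · simp only at hs
    simp only [spaceLaplacian, spaceDeriv_spaceDeriv_heatKernel hs]
    rw [timeDeriv, fderiv_heatKernel hs, ← Finset.mul_sum, Finset.sum_sub_distrib,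
      ← Finset.sum_div]
    have h := (EuclideanSpace.basisFun (Fin 3) ℝ).sum_sq_norm_inner_left y
    simp only [Real.norm_eq_abs, sq_abs] at h
    rw [h]
    simp
    ring_nf
    tauto

end HeatOp

/-! ### The heat potential off the curve -/

/-- The heat potential `∫_0^t G(x-γ(τ), t-τ) dτ` of a unit source moving along `γ`. Since `heatKernel`
vanishes at nonpositive times, the domain of integration can be taken independent of `t`. -/
def heatPotential (γ : ℝ → R3) (x : R3) (t : ℝ) : ℝ :=
  ∫ τ in Ioi (0 : ℝ), heatKernel (x - γ τ, t - τ)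

lemma heatPotential_eq_setIntegral (γ : ℝ → R3) (x : R3) {t T : ℝ} (h : t ≤ T) :
    heatPotential γ x t = ∫ τ in Ioc (0 : ℝ) T, heatKernel (x - γ τ, t - τ) := by
  refine (setIntegral_eq_of_subset_of_forall_sdiff_eq_zero measurableSet_Ioi Ioc_subset_Ioi_self
    fun τ hτ => heatKernel_of_nonpos ?_)
  have : ¬ τ ≤ T := fun hT => hτ.2 ⟨hτ.1, hT⟩
  linarith

section OffCurve
open scoped Topology Convolution

/-- The superposition of the translates of `g` along the space-time curve `τ ↦ (γ(τ), τ)`,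
`0 < τ ≤ T`. -/
def curveSuperposition (γ : ℝ → R3) (T : ℝ) (g : R3 × ℝ → ℝ) (p : R3 × ℝ) : ℝ :=
  ∫ τ in Ioc (0 : ℝ) T, g (p - (γ τ, τ))

/-- The image of Lebesgue measure on `(0,T]` under the space-time curve `τ ↦ (γ(τ), τ)`. -/
def curveMeasure (γ : ℝ → R3) (T : ℝ) : Measure (R3 × ℝ) :=
  (volume.restrict (Ioc (0 : ℝ) T)).map (fun τ => (γ τ, τ))

instance (γ : ℝ → R3) (T : ℝ) : IsFiniteMeasure (curveMeasure γ T) := by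
  unfold curveMeasure; infer_instance

variable {γ : ℝ → R3} {T : ℝ} {g : R3 × ℝ → ℝ}

lemma convolution_curveMeasure (hγ : Continuous γ) (hg : Continuous g) :
    ((fun _ => (1 : ℝ)) ⋆[ContinuousLinearMap.mul ℝ ℝ, curveMeasure γ T] g) =
      curveSuperposition γ T g := by
  ext p
  rw [convolution_def, curveMeasure, integral_map (by fun_prop)
    (by
      refine Continuous.aestronglyMeasurable ?_
      simp only [ContinuousLinearMap.mul_apply', one_mul]
      fun_prop)]
  simp [curveSuperposition]

lemma contDiff_curveSuperposition (hγ : Continuous γ) (hg : ContDiff ℝ ∞ g)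
    (hc : HasCompactSupport g) : ContDiff ℝ ∞ (curveSuperposition γ T g) := by
  rw [← convolution_curveMeasure hγ hg.continuous]
  exact hc.contDiff_convolution_right (n := ⊤) _ (locallyIntegrable_const _) hg

lemma fderiv_curveSuperposition (hγ : Continuous γ) (hg : ContDiff ℝ ∞ g)
    (hc : HasCompactSupport g) (p v : R3 × ℝ) :
    fderiv ℝ (curveSuperposition γ T g) p v =
      curveSuperposition γ T (fun q => fderiv ℝ g q v) p := by
  have hd : Continuous (fderiv ℝ g) := hg.continuous_fderiv (by simp)
  obtain ⟨C, hC⟩ := (hc.fderiv ℝ).exists_bound_of_continuous hd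
  have hgc := hg.continuous
  have h := hasFDerivAt_integral_of_dominated_of_fderiv_le (𝕜 := ℝ)
    (μ := volume.restrict (Ioc (0 : ℝ) T)) (F := fun p τ => g (p - (γ τ, τ)))
    (F' := fun p τ => fderiv ℝ g (p - (γ τ, τ))) (bound := fun _ => C) (x₀ := p)
    Filter.univ_mem
    (Filter.Eventually.of_forall fun p => Continuous.aestronglyMeasurable (by fun_prop))
    (Continuous.integrableOn_Ioc (by fun_prop)) (Continuous.aestronglyMeasurable (by fun_prop))
    (Filter.Eventually.of_forall fun τ p _ => hC _) (integrable_const C)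
    (Filter.Eventually.of_forall fun τ p _ => by
      have h1 := (hg.differentiable (by simp) (p - (γ τ, τ))).hasFDerivAt
      simpa using! h1.comp p ((hasFDerivAt_id p).sub_const (γ τ, τ)))
  have h' : HasFDerivAt (curveSuperposition γ T g) _ p := h
  rw [h'.fderiv, ContinuousLinearMap.integral_apply]
  · rfl
  · exact Continuous.integrableOn_Ioc (by fun_prop)

lemma contDiff_fderiv_apply_right (hg : ContDiff ℝ ∞ g) (v : R3 × ℝ) :
    ContDiff ℝ ∞ (fun q => fderiv ℝ g q v) :=
  (hg.fderiv_right (m := ∞) (by simp)).clm_apply contDiff_const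

lemma timeDeriv_curveSuperposition (hγ : Continuous γ) (hg : ContDiff ℝ ∞ g)
    (hc : HasCompactSupport g) :
    timeDeriv (curveSuperposition γ T g) = curveSuperposition γ T (timeDeriv g) :=
  funext fun p => fderiv_curveSuperposition hγ hg hc p _

lemma spaceDeriv_curveSuperposition (hγ : Continuous γ) (hg : ContDiff ℝ ∞ g)
    (hc : HasCompactSupport g) (i : Fin 3) :
    spaceDeriv i (curveSuperposition γ T g) = curveSuperposition γ T (spaceDeriv i g) :=
  funext fun p => fderiv_curveSuperposition hγ hg hc p _

lemma spaceLaplacian_curveSuperposition (hγ : Continuous γ) (hg : ContDiff ℝ ∞ g)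
    (hc : HasCompactSupport g) :
    spaceLaplacian (curveSuperposition γ T g) = curveSuperposition γ T (spaceLaplacian g) := by
  ext p
  have hi : ∀ i, ContDiff ℝ ∞ (spaceDeriv i g) := fun i => contDiff_fderiv_apply_right hg _
  have hci : ∀ i, HasCompactSupport (spaceDeriv i g) := fun i => hc.fderiv_apply ℝ _
  have hii : ∀ i, Continuous (spaceDeriv i (spaceDeriv i g)) :=
    fun i => (contDiff_fderiv_apply_right (hi i) _).continuous
  simp only [spaceLaplacian]
  simp_rw [spaceDeriv_curveSuperposition hγ hg hc,
    spaceDeriv_curveSuperposition hγ (hi _) (hci _)]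
  simp only [curveSuperposition, spaceLaplacian]
  rw [integral_finsetSum]
  intro i _
  exact Continuous.integrableOn_Ioc (by have := hii i; fun_prop)

/-- Near a point off the curve, the kernel centred on the curve may be replaced by a smooth compactly
supported function: the differences `p - (γ(τ), τ)` stay in an annulus, and the kernel is cut off
outside it. -/
lemma exists_smooth_eq_heatKernel (hγ : Continuous γ) {p₀ : R3 × ℝ}
    (hp : ∀ τ ∈ Icc 0 T, p₀ ≠ (γ τ, τ)) :
    ∃ g : R3 × ℝ → ℝ, ContDiff ℝ ∞ g ∧ HasCompactSupport g ∧
      ∀ᶠ p in 𝓝 p₀, ∀ τ ∈ Icc 0 T, heatKernel =ᶠ[𝓝 (p - (γ τ, τ))] g := by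
  have hK : IsCompact ((fun τ => (γ τ, τ)) '' Icc 0 T) := isCompact_Icc.image (by fun_prop)
  have hmem : p₀ ∉ ((fun τ => (γ τ, τ)) '' Icc 0 T) := by
    rintro ⟨τ, hτ, h⟩
    exact hp τ hτ h.symm
  obtain ⟨δ, hδ, hb⟩ := Metric.isOpen_iff.1 hK.isClosed.isOpen_compl p₀ hmem
  obtain ⟨M, hM⟩ := hK.isBounded.exists_norm_le
  set R : ℝ := ‖p₀‖ + δ + |M| + 1 with hR
  have hR0 : 0 < R := by positivity
  let small : ContDiffBump (0 : R3 × ℝ) := ⟨δ / 8, δ / 4, by positivity, by linarith⟩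
  let big : ContDiffBump (0 : R3 × ℝ) := ⟨R, 2 * R, hR0, by linarith⟩
  have hδR : δ / 8 < R := by rw [hR]; linarith [norm_nonneg p₀, abs_nonneg M]
  refine ⟨fun q => (big q - small q) * heatKernel q, ?_, ?_, ?_⟩
  · rw [contDiff_iff_contDiffAt]
    intro q
    by_cases hq : q = 0
    · subst hq
      refine (contDiffAt_const (c := (0 : ℝ))).congr_of_eventuallyEq ?_
      filter_upwards [Metric.closedBall_mem_nhds (0 : R3 × ℝ) (show 0 < δ / 8 by positivity)]
        with q hq
      rw [small.one_of_mem_closedBall hq,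
        big.one_of_mem_closedBall (Metric.closedBall_subset_closedBall hδR.le hq), sub_self,
        zero_mul]
    · exact (big.contDiff.contDiffAt.sub small.contDiff.contDiffAt).mul (contDiffAt_heatKernel hq)
  · exact (big.hasCompactSupport.sub small.hasCompactSupport).mul_right
  · filter_upwards [Metric.ball_mem_nhds p₀ (half_pos hδ)] with p hp τ hτ
    rw [Metric.mem_ball] at hp
    have h1 : δ ≤ dist (γ τ, τ) p₀ := by
      by_contra! h
      exact hb h ⟨τ, hτ, rfl⟩
    have h2 : δ / 2 ≤ ‖p - (γ τ, τ)‖ := by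
      rw [← dist_eq_norm]
      have := dist_triangle (γ τ, τ) p p₀
      rw [dist_comm (γ τ, τ) p] at this
      linarith
    have h3 : ‖p - (γ τ, τ)‖ < R := by
      have e1 := hM _ ⟨τ, hτ, rfl⟩
      have e2 := norm_sub_le p (γ τ, τ)
      have e3 : ‖p‖ ≤ ‖p₀‖ + δ / 2 := by
        have := norm_le_norm_add_norm_sub p₀ p
        rw [← dist_eq_norm, dist_comm] at this
        linarith
      simp only at e1
      rw [hR]
      linarith [le_abs_self M]
    have o1 : IsOpen {q : R3 × ℝ | δ / 4 < ‖q‖} := isOpen_lt continuous_const continuous_norm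
    have o2 : IsOpen {q : R3 × ℝ | ‖q‖ < R} := isOpen_lt continuous_norm continuous_const
    filter_upwards [o1.mem_nhds (show δ / 4 < _ by linarith), o2.mem_nhds h3] with q hq1 hq2
    rw [big.one_of_mem_closedBall (by simpa using (le_of_lt hq2 : ‖q‖ ≤ R)),
      small.zero_of_le_dist (by simpa using (le_of_lt hq1 : δ / 4 ≤ ‖q‖)), sub_zero, one_mul]

lemma ne_curve_of_mem_offCurve {p : R3 × ℝ} (hp : p ∈ offCurve γ) (τ : ℝ) : p ≠ (γ τ, τ) := by
  rintro rfl
  exact hp.2 ⟨τ, hp.1, rfl⟩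

/-- Near a point off the curve, the heat potential is a superposition of translates of a smooth
compactly supported function which agrees with the heat kernel where it matters. -/
lemma exists_heatPotential_eventuallyEq (hγ : Continuous γ) {p₀ : R3 × ℝ}
    (hp : p₀ ∈ offCurve γ) :
    ∃ g : R3 × ℝ → ℝ, ContDiff ℝ ∞ g ∧ HasCompactSupport g ∧
      (fun p : R3 × ℝ => heatPotential γ p.1 p.2) =ᶠ[𝓝 p₀] curveSuperposition γ (p₀.2 + 1) g ∧
      ∀ τ ∈ Icc 0 (p₀.2 + 1), heatKernel =ᶠ[𝓝 (p₀ - (γ τ, τ))] g := by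
  obtain ⟨g, hg, hc, hev⟩ := exists_smooth_eq_heatKernel (T := p₀.2 + 1) hγ
    (fun τ _ => ne_curve_of_mem_offCurve hp τ)
  refine ⟨g, hg, hc, ?_, hev.self_of_nhds⟩
  filter_upwards [hev, (isOpen_Iio.preimage continuous_snd).mem_nhds
    (show p₀.2 < p₀.2 + 1 by linarith)] with p h1 h2
  rw [heatPotential_eq_setIntegral γ p.1 (le_of_lt h2)]
  refine setIntegral_congr_fun measurableSet_Ioc fun τ hτ => ?_
  exact (h1 τ (Ioc_subset_Icc_self hτ)).eq_of_nhds

lemma contDiffAt_heatPotential (hγ : Continuous γ) {p₀ : R3 × ℝ} (hp : p₀ ∈ offCurve γ) :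
    ContDiffAt ℝ ∞ (fun p : R3 × ℝ => heatPotential γ p.1 p.2) p₀ := by
  obtain ⟨g, hg, hc, he, -⟩ := exists_heatPotential_eventuallyEq hγ hp
  exact (contDiff_curveSuperposition hγ hg hc).contDiffAt.congr_of_eventuallyEq he

lemma heatEquation_heatPotential (hγ : Continuous γ) {x : R3} {t : ℝ} (hp : (x, t) ∈ offCurve γ) :
    deriv (fun s => heatPotential γ x s) t = Δ (fun y => heatPotential γ y t) x := by
  have hd := contDiffAt_heatPotential hγ hp
  rw [deriv_slice (f := fun p : R3 × ℝ => heatPotential γ p.1 p.2)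
      (hd.differentiableAt (by simp)),
    laplacian_slice (f := fun p : R3 × ℝ => heatPotential γ p.1 p.2)
      (hd.of_le (by norm_cast))]
  obtain ⟨g, hg, hc, he, hk⟩ := exists_heatPotential_eventuallyEq hγ hp
  rw [timeDeriv_congr he, spaceLaplacian_congr he, timeDeriv_curveSuperposition hγ hg hc,
    spaceLaplacian_curveSuperposition hγ hg hc]
  refine setIntegral_congr_ae measurableSet_Ioc ?_
  -- The heat equation for the kernel is needed only off the null set `τ = t`.
  have hne : ∀ᵐ τ : ℝ, τ ≠ t := by simp [ae_iff]
  filter_upwards [hne] with τ hτ hτ'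
  have h := hk τ (Ioc_subset_Icc_self hτ')
  rw [← timeDeriv_congr h, ← spaceLaplacian_congr h]
  exact timeDeriv_heatKernel (sub_ne_zero.2 hτ.symm)

end OffCurve

/-! ### The mild formulation -/

section Mild

variable {γ : ℝ → R3}

lemma measurable_heatKernel_curve (hγ : Continuous γ) :
    Measurable (fun z : (R3 × ℝ) × ℝ => heatKernel (z.1.1 - γ z.2, z.1.2 - z.2)) := by
  have := hγ.measurable
  exact measurable_heatKernel.comp (by fun_prop)

lemma measurable_heatKernel_curve_time (hγ : Continuous γ) (t : ℝ) :
    Measurable (fun z : R3 × ℝ => heatKernel (z.1 - γ z.2, t - z.2)) :=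
  (measurable_heatKernel_curve hγ).comp (g := fun z : (R3 × ℝ) × ℝ =>
    heatKernel (z.1.1 - γ z.2, z.1.2 - z.2)) (f := fun z : R3 × ℝ => ((z.1, t), z.2)) (by fun_prop)

lemma ae_lt_of_Ioc (t : ℝ) : ∀ᵐ τ ∂(volume.restrict (Ioc (0 : ℝ) t)), τ < t := by
  have hne : ∀ᵐ τ : ℝ, τ ≠ t := by simp [ae_iff]
  filter_upwards [ae_restrict_of_ae hne, ae_restrict_mem measurableSet_Ioc] with τ h1 h2
  exact lt_of_le_of_ne h2.2 h1

lemma integrable_heatKernel_curve_time (hγ : Continuous γ) (t : ℝ) :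
    Integrable (fun z : R3 × ℝ => heatKernel (z.1 - γ z.2, t - z.2))
      (volume.prod (volume.restrict (Ioc (0 : ℝ) t))) := by
  rw [integrable_prod_iff' (measurable_heatKernel_curve_time hγ t).aestronglyMeasurable]
  refine ⟨Filter.Eventually.of_forall fun τ => (integrable_heatKernel (t - τ)).comp_sub_right (γ τ),
    ?_⟩
  refine (integrable_const (1 : ℝ)).congr ?_
  filter_upwards [ae_lt_of_Ioc t] with τ hτ
  simp only [Real.norm_of_nonneg (heatKernel_nonneg _)]
  rw [integral_sub_right_eq_self (fun y => heatKernel (y, t - τ)) (γ τ),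
    integral_heatKernel (sub_pos.2 hτ)]

lemma integrable_heatPotential (hγ : Continuous γ) (t : ℝ) :
    Integrable (fun x => heatPotential γ x t) := by
  simp only [heatPotential_eq_setIntegral γ _ (le_refl t)]
  exact (integrable_heatKernel_curve_time hγ t).integral_prod_left

variable {E : Type*} [NormedAddCommGroup E] [NormedSpace ℝ E]

lemma integral_heatPotential_smul [CompleteSpace E] (hγ : Continuous γ) (t : ℝ) {f : R3 → E} (hf : Continuous f)
    {C : ℝ} (hC : ∀ x, ‖f x‖ ≤ C) :
    ∫ x, heatPotential γ x t • f x =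
      ∫ τ in Ioc (0 : ℝ) t, ∫ x, heatKernel (x - γ τ, t - τ) • f x := by
  simp only [heatPotential_eq_setIntegral γ _ (le_refl t), ← integral_smul_const]
  refine integral_integral_swap ?_
  refine (integrable_heatKernel_curve_time hγ t).smul_bdd C ?_
    (Filter.Eventually.of_forall fun z => hC z.1)
  exact (hf.comp continuous_fst).aestronglyMeasurable

/-- The average of `f` around `a` with respect to the Gaussian `heatKernel (·, 1)` scaled by `r`. For
`r = √s` it is the heat semigroup at time `s` applied to `f`, evaluated at `a`, and it remains
meaningful and continuous at `s = 0`. -/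
def gaussAverage (f : R3 → E) (a : R3) (r : ℝ) : E := ∫ z : R3, heatKernel (z, 1) • f (a + r • z)

lemma integral_heatKernel_sub_smul {s : ℝ} (hs : 0 < s) (a : R3) (f : R3 → E) :
    ∫ x, heatKernel (x - a, s) • f x = gaussAverage f a (√s) := by
  rw [gaussAverage, ← integral_heatKernel_smul hs (fun y => f (a + y)),
    ← integral_sub_right_eq_self (fun y => heatKernel (y, s) • f (a + y)) a]
  simp

lemma integral_heatPotential_smul_eq_gaussAverage [CompleteSpace E] (hγ : Continuous γ) {t : ℝ} (ht : 0 ≤ t)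
    {f : R3 → E} (hf : Continuous f) {C : ℝ} (hC : ∀ x, ‖f x‖ ≤ C) :
    ∫ x, heatPotential γ x t • f x =
      ∫ τ in (0 : ℝ)..t, gaussAverage f (γ τ) (√(t - τ)) := by
  rw [integral_heatPotential_smul hγ t hf hC, intervalIntegral.integral_of_le ht]
  refine integral_congr_ae ?_
  filter_upwards [ae_lt_of_Ioc t] with τ hτ
  exact integral_heatKernel_sub_smul (sub_pos.2 hτ) _ _

lemma continuous_gaussAverage {X : Type*} [TopologicalSpace X] [FirstCountableTopology X]
    {F : X → R3 → E} (hF : Continuous (Function.uncurry F)) {C : ℝ} (hC : ∀ p x, ‖F p x‖ ≤ C)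
    {a : X → R3} {r : X → ℝ} (ha : Continuous a) (hr : Continuous r) :
    Continuous (fun p => gaussAverage (F p) (a p) (r p)) := by
  have hm : Measurable (fun z : R3 => heatKernel (z, 1)) :=
    measurable_heatKernel.comp (by fun_prop)
  refine continuous_of_dominated (bound := fun z => heatKernel (z, 1) * C) ?_ ?_ ?_ ?_
  · intro p
    have hp : Continuous (fun z => F p (a p + r p • z)) :=
      hF.comp (g := Function.uncurry F) (f := fun z => (p, a p + r p • z)) (by fun_prop)
    exact hm.aestronglyMeasurable.smul hp.aestronglyMeasurable
  · intro p
    refine Filter.Eventually.of_forall fun z => ?_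
    rw [norm_smul, Real.norm_of_nonneg (heatKernel_nonneg _)]
    exact mul_le_mul_of_nonneg_left (hC _ _) (heatKernel_nonneg _)
  · exact (integrable_heatKernel 1).mul_const C
  · refine Filter.Eventually.of_forall fun z => ?_
    refine continuous_const.smul ?_
    exact hF.comp (g := Function.uncurry F) (f := fun p => (p, a p + r p • z)) (by fun_prop)

lemma continuousOn_integral_heatPotential (hγ : Continuous γ) (φ : 𝓢(R3, ℂ)) :
    ContinuousOn (fun t : ℝ => ∫ x, ((heatPotential γ x t : ℝ) : ℂ) * φ x) (Ici 0) := by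
  obtain ⟨C, hC⟩ : ∃ C, ∀ x, ‖φ x‖ ≤ C := by
    obtain ⟨C, hC⟩ := φ.decay 0 0
    exact ⟨C, by simpa using hC.2⟩
  have hc : Continuous fun t : ℝ => ∫ τ in (0 : ℝ)..t, gaussAverage φ (γ τ) (√(t - τ)) := by
    refine intervalIntegral.continuous_parametric_intervalIntegral_of_continuous
      (f := fun t τ => gaussAverage φ (γ τ) (√(t - τ))) ?_ continuous_id
    exact continuous_gaussAverage (X := ℝ × ℝ) (F := fun _ => φ)
      (φ.continuous.comp continuous_snd) (fun _ => hC) (a := fun p => γ p.2)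
      (r := fun p => √(p.1 - p.2)) (by fun_prop) (by fun_prop)
  refine hc.continuousOn.congr fun t ht => ?_
  simp only [← Complex.real_smul]
  exact integral_heatPotential_smul_eq_gaussAverage hγ ht φ.continuous hC

lemma norm_cexp_I_mul_ofReal (r : ℝ) : ‖Complex.exp (Complex.I * (r : ℂ))‖ = 1 := by
  rw [mul_comm, Complex.norm_exp_ofReal_mul_I]

lemma norm_fourierInt_le (φ : 𝓢(R3, ℂ)) (ξ : R3) : ‖fourierInt φ ξ‖ ≤ ∫ x, ‖φ x‖ := by
  refine (norm_integral_le_integral_norm _).trans (le_of_eq ?_)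
  simp

lemma continuous_fourierInt (φ : 𝓢(R3, ℂ)) : Continuous (fourierInt φ) := by
  have hφ := φ.continuous
  refine continuous_of_dominated (bound := fun x => ‖φ x‖) ?_ ?_ φ.integrable.norm ?_
  · intro ξ
    exact Continuous.aestronglyMeasurable (by fun_prop)
  · intro ξ
    exact Filter.Eventually.of_forall fun x => by simp
  · exact Filter.Eventually.of_forall fun x => by fun_prop

/-- Parseval's identity for the translated heat kernel and a Schwartz function. -/
lemma integral_heatKernel_smul_fourierInt {s : ℝ} (hs : 0 < s) (a : R3) (φ : 𝓢(R3, ℂ)) :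
    ∫ x, heatKernel (x - a, s) • fourierInt φ x =
      ∫ ξ, (Complex.exp ((-(s * ‖ξ‖ ^ 2) : ℝ) : ℂ) *
        Complex.exp (Complex.I * ((inner ℝ a ξ : ℝ) : ℂ))) * φ ξ := by
  have hint : Integrable (fun z : R3 × R3 => heatKernel (z.1 - a, s) •
      (Complex.exp (Complex.I * ((inner ℝ z.2 z.1 : ℝ) : ℂ)) * φ z.2)) (volume.prod volume) := by
    have h1 := ((integrable_heatKernel s).comp_sub_right a).ofReal (𝕜 := ℂ)
    have h2 := h1.mul_prod (φ.integrable (μ := volume))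
    have h3 := h2.bdd_mul (c := 1) (f := fun z : R3 × R3 =>
      Complex.exp (Complex.I * ((inner ℝ z.2 z.1 : ℝ) : ℂ)))
      (Continuous.aestronglyMeasurable (by fun_prop))
      (Filter.Eventually.of_forall fun z => (norm_cexp_I_mul_ofReal _).le)
    refine h3.congr (Filter.Eventually.of_forall fun z => ?_)
    simp only [Complex.real_smul, Complex.coe_algebraMap]
    ring
  simp only [fourierInt, ← integral_smul]
  rw [integral_integral_swap hint]
  refine integral_congr_ae (Filter.Eventually.of_forall fun ξ => ?_)
  have h := integral_heatKernel_mul_cexp hs ξ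
  have e : ∀ x : R3, heatKernel (x - a, s) •
      (Complex.exp (Complex.I * ((inner ℝ ξ x : ℝ) : ℂ)) * φ ξ) =
      ((heatKernel (x - a, s) : ℂ) * Complex.exp (Complex.I * ((inner ℝ (x - a) ξ : ℝ) : ℂ))) *
        (Complex.exp (Complex.I * ((inner ℝ a ξ : ℝ) : ℂ)) * φ ξ) := by
    intro x
    have : Complex.exp (Complex.I * ((inner ℝ ξ x : ℝ) : ℂ)) =
        Complex.exp (Complex.I * ((inner ℝ (x - a) ξ : ℝ) : ℂ)) *
          Complex.exp (Complex.I * ((inner ℝ a ξ : ℝ) : ℂ)) := by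
      rw [← Complex.exp_add, real_inner_comm, inner_sub_left]
      congr 1
      push_cast
      ring
    rw [this, Complex.real_smul]
    ring
  simp only [e]
  rw [integral_mul_const, integral_sub_right_eq_self (fun y => (heatKernel (y, s) : ℂ) *
    Complex.exp (Complex.I * ((inner ℝ y ξ : ℝ) : ℂ))) a, h]
  ring

lemma continuous_duhamelFourier_integrand (hγ : Continuous γ) (t : ℝ) :
    Continuous (Function.uncurry fun (ξ : R3) (τ : ℝ) =>
      Complex.exp ((-((t - τ) * ‖ξ‖ ^ 2) : ℝ) : ℂ) *
        Complex.exp (Complex.I * ((inner ℝ (γ τ) ξ : ℝ) : ℂ))) := by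
  have : Continuous fun p : R3 × ℝ => γ p.2 := by fun_prop
  unfold Function.uncurry
  fun_prop

lemma continuous_duhamelFourier (hγ : Continuous γ) (t : ℝ) : Continuous (duhamelFourier γ t) :=
  intervalIntegral.continuous_parametric_intervalIntegral_of_continuous'
    (continuous_duhamelFourier_integrand hγ t) 0 t

lemma norm_duhamelFourier_integrand (t τ : ℝ) (ξ : R3) :
    ‖Complex.exp ((-((t - τ) * ‖ξ‖ ^ 2) : ℝ) : ℂ) *
      Complex.exp (Complex.I * ((inner ℝ (γ τ) ξ : ℝ) : ℂ))‖ = Real.exp (-((t - τ) * ‖ξ‖ ^ 2)) := by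
  rw [norm_mul, norm_cexp_I_mul_ofReal, mul_one, ← Complex.ofReal_exp, Complex.norm_real,
    Real.norm_of_nonneg (Real.exp_pos _).le]

lemma norm_duhamelFourier_le {t : ℝ} (ht : 0 ≤ t) (ξ : R3) :
    ‖duhamelFourier γ t ξ‖ ≤ ∫ τ in (0 : ℝ)..t, Real.exp (-((t - τ) * ‖ξ‖ ^ 2)) := by
  refine (intervalIntegral.norm_integral_le_integral_norm ht).trans (le_of_eq ?_)
  simp only [norm_duhamelFourier_integrand]

lemma norm_duhamelFourier_le_time {t : ℝ} (ht : 0 ≤ t) (ξ : R3) : ‖duhamelFourier γ t ξ‖ ≤ t := by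
  refine (norm_duhamelFourier_le ht ξ).trans ?_
  have : ∫ τ in (0 : ℝ)..t, Real.exp (-((t - τ) * ‖ξ‖ ^ 2)) ≤ ∫ τ in (0 : ℝ)..t, (1 : ℝ) := by
    refine intervalIntegral.integral_mono_on ht (Continuous.intervalIntegrable (by fun_prop) _ _)
      (by simp) fun τ hτ => ?_
    rw [Real.exp_le_one_iff, neg_nonpos]
    exact mul_nonneg (sub_nonneg.2 hτ.2) (sq_nonneg _)
  simpa using this

lemma norm_sq_mul_norm_duhamelFourier_le {t : ℝ} (ht : 0 ≤ t) (ξ : R3) :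
    ‖ξ‖ ^ 2 * ‖duhamelFourier γ t ξ‖ ≤ 1 := by
  have hd : ∀ τ ∈ uIcc 0 t, HasDerivAt (fun τ : ℝ => Real.exp (-((t - τ) * ‖ξ‖ ^ 2)))
      (‖ξ‖ ^ 2 * Real.exp (-((t - τ) * ‖ξ‖ ^ 2))) τ := by
    intro τ _
    have := ((((hasDerivAt_id τ).const_sub t).mul_const (‖ξ‖ ^ 2)).neg).exp
    convert! this using 1
    simp [mul_comm]
  have h := intervalIntegral.integral_eq_sub_of_hasDerivAt hd
    (Continuous.intervalIntegrable (by fun_prop) _ _)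
  rw [intervalIntegral.integral_const_mul] at h
  calc _ ≤ ‖ξ‖ ^ 2 * ∫ τ in (0 : ℝ)..t, Real.exp (-((t - τ) * ‖ξ‖ ^ 2)) := by
        gcongr
        exact norm_duhamelFourier_le ht ξ
    _ ≤ 1 := by
        rw [h]
        simp
        positivity

lemma pmNorm_duhamelFourier_le {t : ℝ} (ht : 0 ≤ t) :
    pmNorm 2 (duhamelFourier γ t) ≤ ENNReal.ofReal 1 := by
  rw [pmNorm, eLpNorm_exponent_top]
  refine eLpNormEssSup_le_of_ae_bound (Filter.Eventually.of_forall fun ξ => ?_)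
  simpa using norm_sq_mul_norm_duhamelFourier_le (γ := γ) ht ξ

lemma integral_heatPotential_mul_fourierInt (hγ : Continuous γ) {t : ℝ} (ht : 0 ≤ t)
    (φ : 𝓢(R3, ℂ)) :
    ∫ x, ((heatPotential γ x t : ℝ) : ℂ) * fourierInt φ x = ∫ ξ, duhamelFourier γ t ξ * φ ξ := by
  simp only [← Complex.real_smul]
  rw [integral_heatPotential_smul hγ t (continuous_fourierInt φ) (norm_fourierInt_le φ)]
  have h1 : ∫ τ in Ioc (0 : ℝ) t, ∫ x, heatKernel (x - γ τ, t - τ) • fourierInt φ x =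
      ∫ τ in Ioc (0 : ℝ) t, ∫ ξ, (Complex.exp ((-((t - τ) * ‖ξ‖ ^ 2) : ℝ) : ℂ) *
        Complex.exp (Complex.I * ((inner ℝ (γ τ) ξ : ℝ) : ℂ))) * φ ξ := by
    refine integral_congr_ae ?_
    filter_upwards [ae_lt_of_Ioc t] with τ hτ
    exact integral_heatKernel_smul_fourierInt (sub_pos.2 hτ) _ φ
  have hint : Integrable (Function.uncurry fun (ξ : R3) (τ : ℝ) =>
      (Complex.exp ((-((t - τ) * ‖ξ‖ ^ 2) : ℝ) : ℂ) *
        Complex.exp (Complex.I * ((inner ℝ (γ τ) ξ : ℝ) : ℂ))) * φ ξ)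
      (volume.prod (volume.restrict (Ioc 0 t))) := by
    have h2 : Integrable (fun z : R3 × ℝ => φ z.1) (volume.prod (volume.restrict (Ioc 0 t))) :=
      φ.integrable.comp_fst _
    refine h2.bdd_mul (c := 1)
      (continuous_duhamelFourier_integrand hγ t).aestronglyMeasurable ?_
    have : ∀ᵐ z ∂((volume : Measure R3).prod (volume.restrict (Ioc 0 t))), z.2 ≤ t := by
      have h3 : ∀ᵐ τ ∂(volume.restrict (Ioc 0 t)), τ ≤ t := by
        filter_upwards [ae_restrict_mem measurableSet_Ioc] with τ hτ using hτ.2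
      exact Measure.quasiMeasurePreserving_snd.ae h3
    filter_upwards [this] with z hz
    refine (norm_duhamelFourier_integrand t z.2 z.1).trans_le ?_
    rw [Real.exp_le_one_iff, neg_nonpos]
    exact mul_nonneg (sub_nonneg.2 hz) (sq_nonneg _)
  rw [h1, ← integral_integral_swap hint]
  refine integral_congr_ae (Filter.Eventually.of_forall fun ξ => ?_)
  simp only
  rw [integral_mul_const, duhamelFourier, intervalIntegral.integral_of_le ht]

lemma isMildSolution_heatPotential (hγ : Continuous γ) : IsMildSolution γ (heatPotential γ) where
  fourier t ht :=
    { locallyIntegrable_left := ((integrable_heatPotential hγ t).ofReal (𝕜 := ℂ)).locallyIntegrable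
      locallyIntegrable_right := (continuous_duhamelFourier hγ t).locallyIntegrable
      integrable_left := fun φ => by
        obtain ⟨C, hC⟩ := φ.decay 0 0
        exact ((integrable_heatPotential hγ t).ofReal (𝕜 := ℂ)).mul_bdd (c := C)
          φ.continuous.aestronglyMeasurable
          (Filter.Eventually.of_forall fun x => by simpa using hC.2 x)
      integrable_right := fun φ => φ.integrable.bdd_mul
        (continuous_duhamelFourier hγ t).aestronglyMeasurable
        (Filter.Eventually.of_forall fun ξ => norm_duhamelFourier_le_time ht ξ)
      pairing := integral_heatPotential_mul_fourierInt hγ ht }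
  bounded := ⟨1, fun _ ht => pmNorm_duhamelFourier_le ht⟩
  weaklyContinuous := continuousOn_integral_heatPotential hγ

end Mild

/-! ### Gaussian averages and integration by parts -/

section Gaussian

lemma norm_mul_heatKernel_one_le (z : R3) :
    heatKernel (z, 1) * ‖z‖ ≤ 2 * 2 ^ (3 / 2 : ℝ) * heatKernel (z, 2) := by
  rw [heatKernel_of_pos one_pos, heatKernel_of_pos two_pos,
    show 4 * Real.pi * 2 = 2 * (4 * Real.pi * 1) by ring,
    Real.mul_rpow (x := 2) (by norm_num) (by positivity)]
  have h2 : (2 : ℝ) ^ (3 / 2 : ℝ) * 2 ^ (-(3 / 2) : ℝ) = 1 := by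
    rw [← Real.rpow_add (by norm_num)]; norm_num
  have h3 : Real.exp (-‖z‖ ^ 2 / (4 * 1)) =
      Real.exp (-‖z‖ ^ 2 / (4 * 2)) * Real.exp (-(‖z‖ ^ 2 / 8)) := by
    rw [← Real.exp_add]; congr 1; ring
  have h4 : ‖z‖ * Real.exp (-(‖z‖ ^ 2 / 8)) ≤ 2 := by
    rw [Real.exp_neg, ← div_eq_mul_inv, div_le_iff₀ (Real.exp_pos _)]
    nlinarith [Real.add_one_le_exp (‖z‖ ^ 2 / 8), sq_nonneg (‖z‖ / 2 - 1)]
  set A := (4 * Real.pi * 1) ^ (-(3 / 2) : ℝ)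
  set B := Real.exp (-‖z‖ ^ 2 / (4 * 2))
  have hA : 0 ≤ A * B := by positivity
  rw [h3]
  calc _ = A * B * (‖z‖ * Real.exp (-(‖z‖ ^ 2 / 8))) := by ring
    _ ≤ A * B * 2 := by gcongr
    _ = _ := by linear_combination (-2 * A * B) * h2

lemma continuous_heatKernel_one : Continuous fun z : R3 => heatKernel (z, 1) := by
  simp only [heatKernel_of_pos one_pos]
  fun_prop

lemma integrable_heatKernel_one_mul_norm :
    Integrable fun z : R3 => heatKernel (z, 1) * ‖z‖ := by
  refine ((integrable_heatKernel 2).const_mul (2 * 2 ^ (3 / 2 : ℝ))).mono'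
    (continuous_heatKernel_one.mul continuous_norm).aestronglyMeasurable
    (Filter.Eventually.of_forall fun z => ?_)
  rw [Real.norm_of_nonneg (mul_nonneg (heatKernel_nonneg _) (norm_nonneg _))]
  exact norm_mul_heatKernel_one_le z

lemma integrable_heatKernel_one_mul {f : R3 → ℝ} (hf : Continuous f) {C : ℝ}
    (hC : ∀ z, |f z| ≤ C * (‖z‖ + 1)) : Integrable fun z : R3 => heatKernel (z, 1) * f z := by
  refine ((integrable_heatKernel_one_mul_norm.add (integrable_heatKernel 1)).const_mul C).mono'
    (continuous_heatKernel_one.mul hf).aestronglyMeasurable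
    (Filter.Eventually.of_forall fun z => ?_)
  rw [norm_mul, Real.norm_of_nonneg (heatKernel_nonneg _), Real.norm_eq_abs]
  have := mul_le_mul_of_nonneg_left (hC z) (heatKernel_nonneg (z, 1))
  simp only [Pi.add_apply]
  linarith

/-- Gaussian integration by parts (Stein's identity). -/
lemma integral_heatKernel_one_mul_inner {f : R3 → ℝ} (hf : ContDiff ℝ 1 f) {C : ℝ}
    (hC : ∀ z, |f z| ≤ C) (hC' : ∀ z, ‖fderiv ℝ f z‖ ≤ C) (v : R3) :
    ∫ z, heatKernel (z, 1) * (inner ℝ z v * f z) =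
      2 * ∫ z, heatKernel (z, 1) * fderiv ℝ f z v := by
  have hfd : Continuous (fderiv ℝ f) := hf.continuous_fderiv one_ne_zero
  have hC0 : 0 ≤ C := (abs_nonneg _).trans (hC 0)
  have hK : ∀ z : R3, DifferentiableAt ℝ heatKernel (z, 1) := fun z =>
    (contDiffAt_heatKernel (by simp)).differentiableAt (by simp)
  have hKd : ∀ z : R3, fderiv ℝ (fun z : R3 => heatKernel (z, 1)) z v =
      heatKernel (z, 1) * (-(inner ℝ z v) / 2) := fun z => by
    rw [fderiv_slice (hK z), fderiv_heatKernel one_pos]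
    simp
  have e : ∀ z : R3, fderiv ℝ (fun z : R3 => heatKernel (z, 1)) z v * f z =
      -(1 / 2) * (heatKernel (z, 1) * (inner ℝ z v * f z)) := fun z => by
    rw [hKd]; ring
  have h := integral_mul_fderiv_eq_neg_fderiv_mul_of_integrable (μ := (volume : Measure R3))
    (f := fun z : R3 => heatKernel (z, 1)) (g := f) (v := v) ?_ ?_ ?_
    (fun z _ => (hK z).comp (f := fun z : R3 => (z, (1 : ℝ))) z (by fun_prop)) (fun z _ => hf.differentiable one_ne_zero z)
  · simp only [e] at h
    rw [integral_const_mul] at h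
    linarith
  · simp only [e]
    refine (integrable_heatKernel_one_mul (f := fun z => inner ℝ z v * f z) (C := ‖v‖ * C)
      (Continuous.mul (by fun_prop) hf.continuous) fun z => ?_).const_mul _
    rw [abs_mul]
    calc _ ≤ (‖z‖ * ‖v‖) * C := by
          gcongr
          · exact abs_real_inner_le_norm z v
          · exact hC z
      _ ≤ _ := by nlinarith [mul_nonneg (norm_nonneg v) hC0]
  · refine integrable_heatKernel_one_mul (C := C * ‖v‖) (by fun_prop) fun z => ?_
    calc _ ≤ ‖fderiv ℝ f z‖ * ‖v‖ := (fderiv ℝ f z).le_opNorm v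
      _ ≤ C * ‖v‖ * 1 := by rw [mul_one]; gcongr; exact hC' z
      _ ≤ _ := by gcongr; linarith [norm_nonneg z]
  · refine integrable_heatKernel_one_mul (C := C) hf.continuous fun z => ?_
    exact (hC z).trans (by nlinarith [norm_nonneg z])

end Gaussian

section TestFunction

variable {φ : R3 × ℝ → ℝ}

lemma contDiff_spaceDeriv (hφ : ContDiff ℝ ∞ φ) (i : Fin 3) : ContDiff ℝ ∞ (spaceDeriv i φ) :=
  contDiff_fderiv_apply_right hφ _

lemma hasCompactSupport_spaceDeriv (hc : HasCompactSupport φ) (i : Fin 3) :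
    HasCompactSupport (spaceDeriv i φ) :=
  hc.fderiv_apply ℝ _

lemma fderiv_smul_one_eq (q : R3 × ℝ) (c : ℝ) (z : R3) :
    fderiv ℝ φ q (c • z, 1) =
      c * ∑ i, inner ℝ z (stdBasis i) * spaceDeriv i φ q + timeDeriv φ q := by
  have h1 : ((c • z, 1) : R3 × ℝ) = c • ∑ i, inner ℝ z (stdBasis i) • (stdBasis i, (0 : ℝ)) +
      (0, 1) := by
    have hz : ∑ i, inner ℝ z (stdBasis i) • stdBasis i = z := by
      conv_rhs => rw [← (EuclideanSpace.basisFun (Fin 3) ℝ).sum_repr' z]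
      simp only [real_inner_comm]
    refine Prod.ext ?_ ?_
    · simp only [Prod.fst_add, Prod.smul_fst, Prod.fst_sum, hz, add_zero]
    · simp [Prod.snd_sum]
  rw [h1, map_add, map_smul, map_sum]
  simp only [map_smul, smul_eq_mul, spaceDeriv, timeDeriv]

lemma integral_heatKernel_one_mul_inner_spaceDeriv (hφ : ContDiff ℝ ∞ φ)
    (hc : HasCompactSupport φ) (a : R3) (t r : ℝ) (i : Fin 3) :
    ∫ z, heatKernel (z, 1) * (inner ℝ z (stdBasis i) * spaceDeriv i φ (a + r • z, t)) =
      2 * r * ∫ z, heatKernel (z, 1) * spaceDeriv i (spaceDeriv i φ) (a + r • z, t) := by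
  have hi := contDiff_spaceDeriv hφ i
  have hci := hasCompactSupport_spaceDeriv hc i
  obtain ⟨C₁, hC₁⟩ := hci.exists_bound_of_continuous hi.continuous
  obtain ⟨C₂, hC₂⟩ := (hci.fderiv ℝ).exists_bound_of_continuous (hi.continuous_fderiv (by simp))
  have hd : ∀ z, HasFDerivAt (fun z : R3 => spaceDeriv i φ (a + r • z, t))
      ((fderiv ℝ (spaceDeriv i φ) (a + r • z, t)).comp
        ((r • ContinuousLinearMap.id ℝ R3).prod 0)) z := by
    intro z
    have h0 : HasFDerivAt (fun z : R3 => (a + r • z, t))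
        ((r • ContinuousLinearMap.id ℝ R3).prod 0) z :=
      (((hasFDerivAt_id z).const_smul r).const_add a).prodMk (hasFDerivAt_const t z)
    exact (hi.differentiable (by simp) _).hasFDerivAt.comp z h0
  have hv : ∀ z v, fderiv ℝ (fun z : R3 => spaceDeriv i φ (a + r • z, t)) z v =
      r * fderiv ℝ (spaceDeriv i φ) (a + r • z, t) (v, 0) := by
    intro z v
    rw [(hd z).fderiv, ← smul_eq_mul, ← map_smul]
    simp
  have h := integral_heatKernel_one_mul_inner (f := fun z => spaceDeriv i φ (a + r • z, t))
    (C := max C₁ (|r| * C₂)) ((hi.of_le (by norm_cast)).comp (by fun_prop))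
    (fun z => (hC₁ _).trans (le_max_left _ _)) (fun z => ?_) (stdBasis i)
  · rw [h]
    have e : ∀ z : R3, heatKernel (z, 1) *
        (r * fderiv ℝ (spaceDeriv i φ) (a + r • z, t) (stdBasis i, 0)) =
        r * (heatKernel (z, 1) * spaceDeriv i (spaceDeriv i φ) (a + r • z, t)) := fun z => by
      rw [spaceDeriv]; ring
    simp only [hv, e]
    rw [integral_const_mul, mul_assoc]
  · refine le_trans ?_ (le_max_right _ _)
    have hC0 : 0 ≤ C₂ := (norm_nonneg _).trans (hC₂ 0)
    refine ContinuousLinearMap.opNorm_le_bound _ (by positivity) fun v => ?_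
    rw [hv, norm_mul, Real.norm_eq_abs r, mul_assoc]
    gcongr
    refine ((fderiv ℝ (spaceDeriv i φ) (a + r • z, t)).le_opNorm _).trans ?_
    have : ‖((v, 0) : R3 × ℝ)‖ = ‖v‖ := by simp [Prod.norm_def]
    rw [this]
    gcongr
    exact hC₂ _

/-- Along the heat flow, `d/ds ∫ G(y-a,s) φ(y,τ+s) dy = ∫ G(y-a,s) (∂ₜφ + Δφ)(y,τ+s) dy`. After
rescaling, the derivative of `√s` produces the moment of the Gaussian against `∇φ`, and Gaussian
integration by parts turns it into the Laplacian. -/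
lemma hasDerivAt_gaussAverage (hφ : ContDiff ℝ ∞ φ) (hc : HasCompactSupport φ) (a : R3) (τ : ℝ)
    {s : ℝ} (hs : 0 < s) :
    HasDerivAt (fun s => gaussAverage (fun y => φ (y, τ + s)) a (√s))
      (gaussAverage (fun y => timeDeriv φ (y, τ + s) + spaceLaplacian φ (y, τ + s)) a (√s)) s := by
  have hfc : Continuous (fderiv ℝ φ) := hφ.continuous_fderiv (by simp)
  obtain ⟨C₁, hC₁⟩ := hc.exists_bound_of_continuous hφ.continuous
  obtain ⟨C, hC⟩ := (hc.fderiv ℝ).exists_bound_of_continuous hfc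
  have hC0 : 0 ≤ C := (norm_nonneg _).trans (hC 0)
  have hφc := hφ.continuous
  have hKc := continuous_heatKernel_one
  have hp : ∀ σ ∈ Metric.ball s (s / 2), s / 2 < σ := by
    intro σ hσ
    rw [Metric.mem_ball, Real.dist_eq, abs_lt] at hσ
    linarith [hσ.1]
  have hq : 0 < √(s / 2) := Real.sqrt_pos.2 (by positivity)
  have h := hasDerivAt_integral_of_dominated_loc_of_deriv_le (μ := (volume : Measure R3))
    (F := fun s z => heatKernel (z, 1) * φ (a + √s • z, τ + s))
    (F' := fun s z => heatKernel (z, 1) *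
      fderiv ℝ φ (a + √s • z, τ + s) ((1 / (2 * √s)) • z, 1))
    (bound := fun z => C * (1 / (2 * √(s / 2))) * (heatKernel (z, 1) * ‖z‖) +
      C * heatKernel (z, 1)) (x₀ := s)
    (Metric.ball_mem_nhds s (half_pos hs))
    (Filter.Eventually.of_forall fun s => Continuous.aestronglyMeasurable (by fun_prop)) ?_
    (Continuous.aestronglyMeasurable (by fun_prop)) ?_ ?_ ?_
  · have h' := h.2
    simp only [gaussAverage, smul_eq_mul]
    convert! h' using 1
    have hi : ∀ i, Integrable fun z : R3 => heatKernel (z, 1) *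
        (inner ℝ z (stdBasis i) * spaceDeriv i φ (a + √s • z, τ + s)) := by
      intro i
      have hic := (contDiff_spaceDeriv hφ i).continuous
      refine integrable_heatKernel_one_mul (C := C) (by fun_prop) fun z => ?_
      have h1 : |inner ℝ z (stdBasis i)| ≤ ‖z‖ := by
        simpa using abs_real_inner_le_norm z (stdBasis i)
      have h2 : |spaceDeriv i φ (a + √s • z, τ + s)| ≤ C := by
        refine ((fderiv ℝ φ _).le_opNorm _).trans ?_
        have : ‖((stdBasis i, 0) : R3 × ℝ)‖ = 1 := by simp [Prod.norm_def]
        rw [this, mul_one]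
        exact hC _
      rw [abs_mul]
      nlinarith [mul_le_mul h1 h2 (abs_nonneg _) (norm_nonneg z)]
    have hii : ∀ i, Integrable fun z : R3 => heatKernel (z, 1) *
        spaceDeriv i (spaceDeriv i φ) (a + √s • z, τ + s) := by
      intro i
      have hic := contDiff_spaceDeriv (contDiff_spaceDeriv hφ i) i
      obtain ⟨D, hD⟩ := (hasCompactSupport_spaceDeriv (hasCompactSupport_spaceDeriv hc i)
        i).exists_bound_of_continuous hic.continuous
      have hicc := hic.continuous
      have hD0 : 0 ≤ D := (norm_nonneg _).trans (hD 0)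
      exact integrable_heatKernel_one_mul (C := D) (by fun_prop) fun z =>
        (hD _).trans (by nlinarith [norm_nonneg z])
    have htime : Integrable fun z : R3 => heatKernel (z, 1) * timeDeriv φ (a + √s • z, τ + s) := by
      have htc : Continuous (timeDeriv φ) := (contDiff_fderiv_apply_right hφ _).continuous
      refine integrable_heatKernel_one_mul (C := C) (by fun_prop) fun z => ?_
      refine ((fderiv ℝ φ _).le_opNorm _).trans ?_
      have : ‖((0, 1) : R3 × ℝ)‖ = 1 := by simp [Prod.norm_def]
      rw [this, mul_one]
      exact (hC _).trans (by nlinarith [norm_nonneg z])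
    have hsq : 0 < √s := Real.sqrt_pos.2 hs
    simp only [fderiv_smul_one_eq, spaceLaplacian, mul_add, Finset.mul_sum]
    rw [integral_add htime (integrable_finsetSum _ fun i _ => hii i),
      integral_finsetSum _ fun i _ => hii i, integral_add _ htime, integral_finsetSum, add_comm]
    · congr 1
      refine Finset.sum_congr rfl fun i _ => ?_
      have e : ∀ z : R3, heatKernel (z, 1) * (1 / (2 * √s) * (inner ℝ z (stdBasis i) *
          spaceDeriv i φ (a + √s • z, τ + s))) = 1 / (2 * √s) * (heatKernel (z, 1) *
          (inner ℝ z (stdBasis i) * spaceDeriv i φ (a + √s • z, τ + s))) := fun z => by ring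
      simp only [e]
      rw [integral_const_mul, integral_heatKernel_one_mul_inner_spaceDeriv hφ hc]
      field_simp
    · intro i _
      refine ((hi i).const_mul (1 / (2 * √s))).congr (Filter.Eventually.of_forall fun z => ?_)
      simp only; ring
    · refine integrable_finsetSum _ fun i _ => ?_
      refine ((hi i).const_mul (1 / (2 * √s))).congr (Filter.Eventually.of_forall fun z => ?_)
      simp only; ring
  · have hC10 : 0 ≤ C₁ := (norm_nonneg _).trans (hC₁ 0)
    exact integrable_heatKernel_one_mul (C := C₁) (by fun_prop) fun z =>
      (hC₁ _).trans (by nlinarith [norm_nonneg z])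
  · refine Filter.Eventually.of_forall fun z σ hσ => ?_
    have hσ' := hp σ hσ
    have h1 : ‖(((1 / (2 * √σ)) • z, 1) : R3 × ℝ)‖ ≤ 1 / (2 * √(s / 2)) * ‖z‖ + 1 := by
      rw [Prod.norm_def]
      refine max_le ?_ ?_
      · rw [norm_smul, Real.norm_of_nonneg (by positivity)]
        have : 1 / (2 * √σ) ≤ 1 / (2 * √(s / 2)) := by gcongr
        nlinarith [mul_le_mul_of_nonneg_right this (norm_nonneg z)]
      · rw [norm_one]
        have : 0 ≤ 1 / (2 * √(s / 2)) * ‖z‖ := by positivity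
        linarith
    rw [norm_mul, Real.norm_of_nonneg (heatKernel_nonneg _)]
    calc _ ≤ heatKernel (z, 1) * (C * (1 / (2 * √(s / 2)) * ‖z‖ + 1)) := by
          refine mul_le_mul_of_nonneg_left ?_ (heatKernel_nonneg _)
          refine ((fderiv ℝ φ _).le_opNorm _).trans ?_
          exact mul_le_mul (hC _) h1 (norm_nonneg _) hC0
      _ = _ := by ring
  · exact (integrable_heatKernel_one_mul_norm.const_mul _).add
      ((integrable_heatKernel 1).const_mul _)
  · refine Filter.Eventually.of_forall fun z σ hσ => ?_
    have hσ' : 0 < σ := (half_pos hs).trans (hp σ hσ)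
    have h1 : HasDerivAt (fun σ : ℝ => (a + √σ • z, τ + σ)) ((1 / (2 * √σ)) • z, 1) σ :=
      (((Real.hasDerivAt_sqrt hσ'.ne').smul_const z).const_add a).prodMk
        ((hasDerivAt_id σ).const_add τ)
    exact ((hφ.differentiable (by simp) _).hasFDerivAt.comp_hasDerivAt σ h1).const_mul _

end TestFunction

/-! ### The distributional formulation -/

section Distributional

variable {γ : ℝ → R3} {φ : R3 × ℝ → ℝ}

/-- The backward heat operator `-∂ₜφ - Δφ`, the adjoint of the heat operator. -/
def backwardHeat (φ : R3 × ℝ → ℝ) (q : R3 × ℝ) : ℝ := -timeDeriv φ q - spaceLaplacian φ q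

lemma continuous_backwardHeat (hφ : ContDiff ℝ ∞ φ) : Continuous (backwardHeat φ) := by
  have h1 : Continuous (timeDeriv φ) := (contDiff_fderiv_apply_right hφ _).continuous
  have h2 : ∀ i, Continuous (spaceDeriv i (spaceDeriv i φ)) := fun i =>
    (contDiff_spaceDeriv (contDiff_spaceDeriv hφ i) i).continuous
  have h3 : Continuous (spaceLaplacian φ) := continuous_finsetSum _ fun i _ => h2 i
  exact h1.neg.sub h3

lemma backwardHeat_eq_zero {q : R3 × ℝ} (hq : q ∉ tsupport φ) : backwardHeat φ q = 0 := by
  have h := notMem_tsupport_iff_eventuallyEq.1 hq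
  rw [backwardHeat, timeDeriv_congr h, spaceLaplacian_congr h]
  have h0 : ∀ i, spaceDeriv i (0 : R3 × ℝ → ℝ) = 0 := fun i => by ext; simp [spaceDeriv]
  simp [timeDeriv, spaceLaplacian, h0]

lemma hasCompactSupport_backwardHeat (hc : HasCompactSupport φ) :
    HasCompactSupport (backwardHeat φ) :=
  HasCompactSupport.intro hc fun _ hq => backwardHeat_eq_zero hq

/-- A compactly supported function on space-time vanishes after some positive time. -/
lemma exists_time_bound (hc : HasCompactSupport φ) :
    ∃ T : ℝ, 0 < T ∧ ∀ (x : R3) (t : ℝ), T ≤ t → (x, t) ∉ tsupport φ := by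
  obtain ⟨M, hM⟩ := hc.isBounded.exists_norm_le
  refine ⟨|M| + 1, by positivity, fun x t ht h => ?_⟩
  have h1 := (norm_snd_le (x, t)).trans (hM _ h)
  simp only [Real.norm_eq_abs] at h1
  linarith [le_abs_self t, le_abs_self M]

lemma gaussAverage_zero_fun (a : R3) (r : ℝ) : gaussAverage (fun _ => (0 : ℝ)) a r = 0 := by
  simp [gaussAverage]

lemma gaussAverage_zero_scale (f : R3 → ℝ) (a : R3) : gaussAverage f a 0 = f a := by
  simp [gaussAverage, integral_mul_const, integral_heatKernel one_pos]

/-- The heat kernel is a fundamental solution of the heat equation, in a form where the time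
integral is outermost. -/
lemma integral_gaussAverage_backwardHeat (hφ : ContDiff ℝ ∞ φ) (hc : HasCompactSupport φ)
    (a : R3) (τ : ℝ) {S : ℝ} (hS : 0 ≤ S) (hT : ∀ x t, τ + S ≤ t → (x, t) ∉ tsupport φ) :
    ∫ s in (0 : ℝ)..S, gaussAverage (fun y => backwardHeat φ (y, τ + s)) a (√s) = φ (a, τ) := by
  obtain ⟨C₁, hC₁⟩ := hc.exists_bound_of_continuous hφ.continuous
  have hb := continuous_backwardHeat hφ
  have hφc := hφ.continuous
  obtain ⟨C₂, hC₂⟩ := (hasCompactSupport_backwardHeat hc).exists_bound_of_continuous hb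
  have hF : Continuous fun s : ℝ => gaussAverage (fun y => φ (y, τ + s)) a (√s) :=
    continuous_gaussAverage (F := fun s y => φ (y, τ + s)) (by unfold Function.uncurry; fun_prop)
      (fun s y => hC₁ _) continuous_const Real.continuous_sqrt
  have hF' : Continuous fun s : ℝ => gaussAverage (fun y => backwardHeat φ (y, τ + s)) a (√s) :=
    continuous_gaussAverage (F := fun s y => backwardHeat φ (y, τ + s))
      (by unfold Function.uncurry; fun_prop) (fun s y => hC₂ _) continuous_const
      Real.continuous_sqrt
  have h := intervalIntegral.integral_eq_sub_of_hasDerivAt_of_le hS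
    (f := fun s => -gaussAverage (fun y => φ (y, τ + s)) a (√s))
    (f' := fun s => gaussAverage (fun y => backwardHeat φ (y, τ + s)) a (√s))
    hF.neg.continuousOn (fun s hs => by
      convert! (hasDerivAt_gaussAverage hφ hc a τ hs.1).neg using 1
      rw [gaussAverage, gaussAverage, ← integral_neg]
      congr 1
      ext z
      simp only [backwardHeat, smul_eq_mul]
      ring) (hF'.intervalIntegrable _ _)
  rw [h]
  have h0 : (fun y => φ (y, τ + S)) = fun _ => 0 :=
    funext fun y => image_eq_zero_of_notMem_tsupport (hT y _ le_rfl)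
  rw [h0, gaussAverage_zero_fun, Real.sqrt_zero, gaussAverage_zero_scale]
  simp

/-- The heat kernel restricted to times at most `T`, which makes it integrable on space-time. -/
def truncatedKernel (T : ℝ) : R3 × ℝ → ℝ := {p : R3 × ℝ | p.2 ≤ T}.indicator heatKernel

lemma measurable_truncatedKernel (T : ℝ) : Measurable (truncatedKernel T) :=
  measurable_heatKernel.indicator (measurableSet_le measurable_snd measurable_const)

lemma truncatedKernel_apply_of_le {T s : ℝ} (hs : s ≤ T) (y : R3) :
    truncatedKernel T (y, s) = heatKernel (y, s) :=
  indicator_of_mem (show (y, s) ∈ {p : R3 × ℝ | p.2 ≤ T} from hs) _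

lemma truncatedKernel_apply_of_lt {T s : ℝ} (hs : T < s) (y : R3) :
    truncatedKernel T (y, s) = 0 :=
  indicator_of_notMem (show (y, s) ∉ {p : R3 × ℝ | p.2 ≤ T} from not_le.2 hs) _

lemma integrable_truncatedKernel (T : ℝ) :
    Integrable (truncatedKernel T) (volume : Measure (R3 × ℝ)) := by
  rw [Measure.volume_eq_prod,
    integrable_prod_iff' (measurable_truncatedKernel T).aestronglyMeasurable]
  constructor
  · refine Filter.Eventually.of_forall fun s => ?_
    rcases le_or_gt s T with hs | hs
    · simpa only [truncatedKernel_apply_of_le hs] using integrable_heatKernel s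
    · simp [truncatedKernel_apply_of_lt hs]
  · have h : IntegrableOn (fun _ : ℝ => (1 : ℝ)) (Ioc 0 T) := by simp
    refine (h.integrable_indicator measurableSet_Ioc).congr (Filter.Eventually.of_forall fun s => ?_)
    simp only
    rcases le_or_gt s T with hs | hs
    · simp only [truncatedKernel_apply_of_le hs, Real.norm_of_nonneg (heatKernel_nonneg _)]
      rcases le_or_gt s 0 with hs0 | hs0
      · simp [heatKernel_of_nonpos hs0, hs0]
      · rw [integral_heatKernel hs0, indicator_of_mem (show s ∈ Ioc 0 T from ⟨hs0, hs⟩)]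
    · simp [truncatedKernel_apply_of_lt hs, hs]

instance : (volume : Measure (R3 × ℝ)).IsAddRightInvariant := by
  rw [Measure.volume_eq_prod]
  infer_instance

lemma integrable_truncatedKernel_curve (hγ : Continuous γ) (T : ℝ) :
    Integrable (fun z : (R3 × ℝ) × ℝ => truncatedKernel T (z.1 - (γ z.2, z.2)))
      (volume.prod (volume.restrict (Ioc (0 : ℝ) T))) := by
  have hm : Measurable (fun z : (R3 × ℝ) × ℝ => truncatedKernel T (z.1 - (γ z.2, z.2))) := by
    have := hγ.measurable
    exact (measurable_truncatedKernel T).comp (by fun_prop)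
  have h1 : ∀ τ : ℝ, Integrable (fun p : R3 × ℝ => truncatedKernel T (p - (γ τ, τ))) := fun τ =>
    (integrable_truncatedKernel T).comp_sub_right (γ τ, τ)
  have h2 : ∀ τ : ℝ, ∫ p : R3 × ℝ, ‖truncatedKernel T (p - (γ τ, τ))‖ =
      ∫ p : R3 × ℝ, ‖truncatedKernel T p‖ := fun τ =>
    integral_sub_right_eq_self (fun p => ‖truncatedKernel T p‖) (γ τ, τ)
  rw [integrable_prod_iff' hm.aestronglyMeasurable]
  refine ⟨Filter.Eventually.of_forall h1, ?_⟩
  refine Integrable.congr (integrable_const (∫ p : R3 × ℝ, ‖truncatedKernel T p‖))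
    (Filter.Eventually.of_forall fun τ => ?_)
  exact (h2 τ).symm

lemma integrable_curveSuperposition_truncatedKernel (hγ : Continuous γ) (T : ℝ) :
    Integrable (curveSuperposition γ T (truncatedKernel T)) :=
  (integrable_truncatedKernel_curve hγ T).integral_prod_left

lemma heatPotential_eq_curveSuperposition (γ : ℝ → R3) {p : R3 × ℝ} {T : ℝ} (h : p.2 ≤ T) :
    heatPotential γ p.1 p.2 = curveSuperposition γ T (truncatedKernel T) p := by
  rw [heatPotential_eq_setIntegral γ p.1 h]
  refine setIntegral_congr_fun measurableSet_Ioc fun τ hτ => ?_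
  exact (truncatedKernel_apply_of_le (by linarith [hτ.1] : p.2 - τ ≤ T) _).symm

lemma locallyIntegrable_heatPotential (hγ : Continuous γ) :
    LocallyIntegrable (fun p : R3 × ℝ => heatPotential γ p.1 p.2) := by
  intro p
  refine ⟨{q | q.2 < p.2 + 1}, (isOpen_lt continuous_snd continuous_const).mem_nhds
    (show p.2 < p.2 + 1 by linarith), ?_⟩
  refine (integrable_curveSuperposition_truncatedKernel hγ (p.2 + 1)).integrableOn.congr_fun
    (fun q hq => ?_) (measurableSet_lt measurable_snd measurable_const)
  exact (heatPotential_eq_curveSuperposition γ (le_of_lt hq)).symm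

/-- The heat kernel with pole `(a, τ)` is a fundamental solution; the truncation is invisible to test
functions that vanish after time `T`. -/
lemma integral_truncatedKernel_mul_backwardHeat (hφ : ContDiff ℝ ∞ φ) (hc : HasCompactSupport φ)
    {T : ℝ} (hT0 : 0 < T) (hT : ∀ x t, T ≤ t → (x, t) ∉ tsupport φ) (a : R3) {τ : ℝ} (hτ : 0 < τ) :
    ∫ p : R3 × ℝ, truncatedKernel T (p - (a, τ)) * backwardHeat φ p = φ (a, τ) := by
  have hb := continuous_backwardHeat hφ
  obtain ⟨C₂, hC₂⟩ := (hasCompactSupport_backwardHeat hc).exists_bound_of_continuous hb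
  rw [← integral_add_right_eq_self _ (a, τ)]
  simp only [add_sub_cancel_right]
  have hint : Integrable (fun p : R3 × ℝ => truncatedKernel T p * backwardHeat φ (p + (a, τ)))
      (volume.prod volume) :=
    (integrable_truncatedKernel T).mul_bdd (c := C₂) (Continuous.aestronglyMeasurable (by fun_prop))
      (Filter.Eventually.of_forall fun p => hC₂ _)
  rw [Measure.volume_eq_prod, integral_prod_symm _ hint]
  rw [← integral_gaussAverage_backwardHeat hφ hc a τ hT0.le
    (fun x t ht => hT x t (by linarith)), intervalIntegral.integral_of_le hT0.le,
    ← integral_indicator measurableSet_Ioc]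
  refine integral_congr_ae (Filter.Eventually.of_forall fun s => ?_)
  simp only
  by_cases hs : s ∈ Ioc 0 T
  · rw [indicator_of_mem hs, ← integral_heatKernel_sub_smul hs.1,
      ← integral_add_right_eq_self
        (fun y => heatKernel (y - a, s) • backwardHeat φ (y, τ + s)) a]
    refine integral_congr_ae (Filter.Eventually.of_forall fun y => ?_)
    simp only [add_sub_cancel_right, smul_eq_mul, truncatedKernel_apply_of_le hs.2, Prod.mk_add_mk,
      add_comm s τ]
  · rw [indicator_of_notMem hs]
    rcases le_or_gt s 0 with h0 | h0
    · simp [truncatedKernel_apply_of_le (h0.trans hT0.le), heatKernel_of_nonpos h0]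
    · have : T < s := by
        by_contra! h
        exact hs ⟨h0, h⟩
      simp [truncatedKernel_apply_of_lt this]

lemma integral_heatPotential_mul_backwardHeat (hγ : Continuous γ) (hφ : ContDiff ℝ ∞ φ)
    (hc : HasCompactSupport φ) :
    ∫ p in {p : R3 × ℝ | 0 < p.2}, heatPotential γ p.1 p.2 * backwardHeat φ p =
      ∫ t in Ioi (0 : ℝ), φ (γ t, t) := by
  obtain ⟨T, hT0, hT⟩ := exists_time_bound hc
  have hb := continuous_backwardHeat hφ
  obtain ⟨C₂, hC₂⟩ := (hasCompactSupport_backwardHeat hc).exists_bound_of_continuous hb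
  have h1 : ∫ p in {p : R3 × ℝ | 0 < p.2}, heatPotential γ p.1 p.2 * backwardHeat φ p =
      ∫ p : R3 × ℝ, heatPotential γ p.1 p.2 * backwardHeat φ p := by
    refine setIntegral_eq_integral_of_forall_compl_eq_zero fun p hp => ?_
    have hp' : p.2 ≤ 0 := not_lt.1 hp
    rw [heatPotential_eq_setIntegral γ p.1 hp']
    simp
  have h2 : ∀ p : R3 × ℝ, heatPotential γ p.1 p.2 * backwardHeat φ p =
      ∫ τ in Ioc (0 : ℝ) T, truncatedKernel T (p - (γ τ, τ)) * backwardHeat φ p := by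
    intro p
    rcases le_or_gt p.2 T with hp | hp
    · rw [heatPotential_eq_curveSuperposition γ hp, curveSuperposition, integral_mul_const]
    · simp [backwardHeat_eq_zero (hT p.1 p.2 hp.le)]
  have hint : Integrable (Function.uncurry fun (p : R3 × ℝ) (τ : ℝ) =>
      truncatedKernel T (p - (γ τ, τ)) * backwardHeat φ p)
      (volume.prod (volume.restrict (Ioc (0 : ℝ) T))) :=
    (integrable_truncatedKernel_curve hγ T).mul_bdd (c := C₂)
      (Continuous.aestronglyMeasurable (by fun_prop)) (Filter.Eventually.of_forall fun z => hC₂ _)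
  rw [h1]
  simp only [h2]
  rw [integral_integral_swap hint]
  have h3 : ∫ t in Ioi (0 : ℝ), φ (γ t, t) = ∫ t in Ioc (0 : ℝ) T, φ (γ t, t) := by
    refine setIntegral_eq_of_subset_of_forall_sdiff_eq_zero measurableSet_Ioi Ioc_subset_Ioi_self
      fun t ht => image_eq_zero_of_notMem_tsupport (hT _ _ ?_)
    by_contra! h
    exact ht.2 ⟨ht.1, h.le⟩
  rw [h3]
  exact setIntegral_congr_fun measurableSet_Ioc fun τ hτ =>
    integral_truncatedKernel_mul_backwardHeat hφ hc hT0 hT _ hτ.1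

lemma isDistributionalSolution_heatPotential (hγ : Continuous γ) :
    IsDistributionalSolution γ (heatPotential γ) where
  locallyIntegrable := (locallyIntegrable_heatPotential hγ).locallyIntegrableOn _
  weak φ hφ hc := by
    rw [← integral_heatPotential_mul_backwardHeat hγ hφ hc]
    refine integral_congr_ae (Filter.Eventually.of_forall fun p => ?_)
    simp only
    rw [deriv_slice (hφ.differentiable (by simp) _),
      laplacian_slice ((hφ.of_le (by norm_cast)).contDiffAt), backwardHeat]

end Distributional

/-! ### Minkowski's integral inequality -/

section Minkowski

variable {X Y : Type*} [MeasurableSpace X] [MeasurableSpace Y] {μ : Measure X} {ν : Measure Y}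

/-- Hölder's inequality with the weight `w` distributed over the two factors. -/
lemma lintegral_rpow_le_weighted {f w : Y → ℝ≥0∞} (hf : Measurable f) (hw : Measurable w)
    (hw0 : ∀ᵐ τ ∂ν, w τ ≠ 0) (hwt : ∀ᵐ τ ∂ν, w τ ≠ ⊤) {q : ℝ} (hq : 1 < q) :
    (∫⁻ τ, f τ ∂ν) ^ q ≤
      (∫⁻ τ, f τ ^ q * w τ ^ (1 - q) ∂ν) * (∫⁻ τ, w τ ∂ν) ^ (q - 1) := by
  have hq0 : 0 < q := by linarith
  have hc := Real.HolderConjugate.conjExponent hq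
  have hq' := hc.symm.pos
  have ha : 1 / q.conjExponent = 1 - 1 / q := by
    have := hc.inv_add_inv_eq_one
    simp only [one_div]
    linarith
  have h1 : ∫⁻ τ, f τ ∂ν =
      ∫⁻ τ, ((fun τ => f τ * w τ ^ (-(1 / q.conjExponent))) *
        fun τ => w τ ^ (1 / q.conjExponent)) τ ∂ν := by
    refine lintegral_congr_ae ?_
    filter_upwards [hw0, hwt] with τ h0 ht
    rw [Pi.mul_apply, mul_assoc, ← ENNReal.rpow_add _ _ h0 ht, neg_add_cancel, ENNReal.rpow_zero,
      mul_one]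
  have h2 := ENNReal.lintegral_mul_le_Lp_mul_Lq ν hc
    (f := fun τ => f τ * w τ ^ (-(1 / q.conjExponent)))
    (g := fun τ => w τ ^ (1 / q.conjExponent)) (by fun_prop) (by fun_prop)
  rw [← h1] at h2
  refine (ENNReal.rpow_le_rpow h2 hq0.le).trans (le_of_eq ?_)
  rw [ENNReal.mul_rpow_of_nonneg _ _ hq0.le, ← ENNReal.rpow_mul, ← ENNReal.rpow_mul,
    one_div_mul_cancel hq0.ne', ENNReal.rpow_one, ha]
  have e1 : (1 - 1 / q) * q = q - 1 := by field_simp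
  have e2 : ∀ τ, (w τ ^ (1 - 1 / q)) ^ q.conjExponent = w τ := fun τ => by
    rw [← ENNReal.rpow_mul, ← ha, one_div_mul_cancel hq'.ne', ENNReal.rpow_one]
  have e3 : ∀ τ, (f τ * w τ ^ (-(1 - 1 / q))) ^ q = f τ ^ q * w τ ^ (1 - q) := fun τ => by
    rw [ENNReal.mul_rpow_of_nonneg _ _ hq0.le, ← ENNReal.rpow_mul]
    congr 2
    field_simp
    ring
  simp only [e1, e2, e3]

/-- Minkowski's integral inequality, for a majorant `w(τ)` of the `L^q` norms of the integrand: apply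
Hölder's inequality with weight `w` in `τ`, then Tonelli's theorem. -/
lemma eLpNorm_lintegral_le [SFinite μ] [SFinite ν] {f : X → Y → ℝ≥0∞}
    (hf : Measurable (Function.uncurry f)) {w : Y → ℝ≥0∞} (hw : Measurable w)
    (hw0 : ∀ᵐ τ ∂ν, w τ ≠ 0) (hwt : ∀ᵐ τ ∂ν, w τ ≠ ⊤) {q : ℝ} (hq : 1 < q)
    (h : ∀ᵐ τ ∂ν, ∫⁻ x, f x τ ^ q ∂μ ≤ w τ ^ q) :
    eLpNorm (fun x => ∫⁻ τ, f x τ ∂ν) (ENNReal.ofReal q) μ ≤ ∫⁻ τ, w τ ∂ν := by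
  have hq0 : 0 < q := by linarith
  rw [eLpNorm_eq_lintegral_rpow_enorm_toReal (by simpa using hq0) ENNReal.ofReal_ne_top,
    ENNReal.toReal_ofReal hq0.le, one_div, ENNReal.rpow_inv_le_iff hq0]
  simp only [enorm_eq_self]
  have hfx : ∀ x, Measurable (f x) := fun x => hf.of_uncurry_left
  calc ∫⁻ x, (∫⁻ τ, f x τ ∂ν) ^ q ∂μ
      ≤ ∫⁻ x, (∫⁻ τ, f x τ ^ q * w τ ^ (1 - q) ∂ν) * (∫⁻ τ, w τ ∂ν) ^ (q - 1) ∂μ :=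
        lintegral_mono fun x => lintegral_rpow_le_weighted (hfx x) hw hw0 hwt hq
    _ = (∫⁻ x, ∫⁻ τ, f x τ ^ q * w τ ^ (1 - q) ∂ν ∂μ) * (∫⁻ τ, w τ ∂ν) ^ (q - 1) := by
        refine lintegral_mul_const _ (Measurable.lintegral_prod_right
          (f := fun x τ => f x τ ^ q * w τ ^ (1 - q)) ?_)
        exact (hf.pow_const q).mul ((hw.comp measurable_snd).pow_const _)
    _ = (∫⁻ τ, ∫⁻ x, f x τ ^ q * w τ ^ (1 - q) ∂μ ∂ν) * (∫⁻ τ, w τ ∂ν) ^ (q - 1) := by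
        rw [lintegral_lintegral_swap]
        exact ((hf.pow_const q).mul ((hw.comp measurable_snd).pow_const _)).aemeasurable
    _ ≤ (∫⁻ τ, w τ ∂ν) * (∫⁻ τ, w τ ∂ν) ^ (q - 1) := by
        gcongr ?_ * _
        refine lintegral_mono_ae ?_
        filter_upwards [hw0, hwt, h] with τ h0 ht hτ
        rw [lintegral_mul_const _ (hf.of_uncurry_right.pow_const q)]
        calc _ ≤ w τ ^ q * w τ ^ (1 - q) := by gcongr
          _ = w τ := by
            rw [← ENNReal.rpow_add _ _ h0 ht, add_sub_cancel, ENNReal.rpow_one]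
    _ = (∫⁻ τ, w τ ∂ν) ^ q := by
        nth_rewrite 1 [← ENNReal.rpow_one (∫⁻ τ, w τ ∂ν)]
        rw [← ENNReal.rpow_add_of_nonneg _ _ zero_le_one (by linarith), add_sub_cancel]

end Minkowski

/-! ### The remainder -/

section Remainder

variable {γ : ℝ → R3}

lemma eLpNorm_lintegral_heatKernel_le {ν : Measure ℝ} [SFinite ν] {a : ℝ → R3} {m σ : ℝ → ℝ}
    (ha : Measurable a) (hm : Measurable m) (hσ : Measurable σ)
    (hpos : ∀ᵐ τ ∂ν, 0 < m τ ∧ 0 < σ τ) {q c β : ℝ} (hq : 1 < q) (hc : 0 < c)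
    (hK : ∀ s : ℝ, 0 < s → ∫⁻ y : R3, ENNReal.ofReal (heatKernel (y, s)) ^ q =
      ENNReal.ofReal (c * s ^ β) ^ q) :
    eLpNorm (fun x : R3 => ∫⁻ τ, ENNReal.ofReal (m τ * heatKernel (x - a τ, σ τ)) ∂ν)
      (ENNReal.ofReal q) volume ≤ ∫⁻ τ, ENNReal.ofReal (m τ * (c * σ τ ^ β)) ∂ν := by
  have hq0 : 0 < q := by linarith
  refine eLpNorm_lintegral_le (f := fun x τ => ENNReal.ofReal (m τ * heatKernel (x - a τ, σ τ)))
    ?_ (by fun_prop) ?_ (by simp) hq ?_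
  · have h1 : Measurable fun z : R3 × ℝ => heatKernel (z.1 - a z.2, σ z.2) :=
      measurable_heatKernel.comp (by fun_prop)
    unfold Function.uncurry
    fun_prop
  · filter_upwards [hpos] with τ hτ
    have h1 := hτ.1
    have h2 := hτ.2
    simpa using (by positivity : 0 < m τ * (c * σ τ ^ β))
  · filter_upwards [hpos] with τ hτ
    simp only [ENNReal.ofReal_mul hτ.1.le, ENNReal.mul_rpow_of_nonneg _ _ hq0.le]
    rw [lintegral_const_mul' _ _ (by finiteness),
      lintegral_sub_right_eq_self (fun y => ENNReal.ofReal (heatKernel (y, σ τ)) ^ q) (a τ),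
      hK _ hτ.2, ENNReal.ofReal_mul hc.le]

lemma lintegral_Ioc_sub_rpow {k e t : ℝ} (hk : 0 ≤ k) (he : -1 < e) (ht : 0 < t) :
    ∫⁻ τ in Ioc 0 t, ENNReal.ofReal (k * (t - τ) ^ e) =
      ENNReal.ofReal (k * (t ^ (e + 1) / (e + 1))) := by
  have hi : IntervalIntegrable (fun τ : ℝ => (t - τ) ^ e) volume 0 t := by
    have := (intervalIntegral.intervalIntegrable_rpow' he (a := 0) (b := t)).comp_sub_left t
    simpa using this.symm
  rw [← ofReal_integral_eq_lintegral_ofReal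
    (((intervalIntegrable_iff_integrableOn_Ioc_of_le ht.le).1 hi).const_mul k),
    ← intervalIntegral.integral_of_le ht.le, intervalIntegral.integral_const_mul,
    intervalIntegral.integral_comp_sub_left (fun s => s ^ e) t, sub_self, sub_zero,
    integral_rpow (Or.inl he), Real.zero_rpow (by linarith), sub_zero]
  filter_upwards [ae_restrict_mem measurableSet_Ioc] with τ hτ
  exact mul_nonneg hk (Real.rpow_nonneg (sub_nonneg.2 hτ.2) _)

lemma lintegral_Ioi_rpow {k e t : ℝ} (hk : 0 ≤ k) (he : e < -1) (ht : 0 < t) :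
    ∫⁻ s in Ioi t, ENNReal.ofReal (k * s ^ e) =
      ENNReal.ofReal (k * (t ^ (e + 1) / (-(e + 1)))) := by
  rw [← ofReal_integral_eq_lintegral_ofReal ((integrableOn_Ioi_rpow_of_lt he ht).const_mul k),
    integral_const_mul, integral_Ioi_rpow_of_lt he ht, div_neg, neg_div]
  filter_upwards [ae_restrict_mem measurableSet_Ioi] with s hs
  exact mul_nonneg hk (Real.rpow_nonneg (ht.trans hs).le _)

/-- The remainder `u(x,t) - 1/(4π|x-γ(t)|)` of the heat potential `u` of the curve. -/
def remainder (γ : ℝ → R3) (x : R3) (t : ℝ) : ℝ :=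
  heatPotential γ x t - 1 / (4 * Real.pi * ‖x - γ t‖)

lemma integral_heatKernel_Ioc_reflect {x : R3} {t : ℝ} (ht : 0 < t) :
    ∫ s in Ioc 0 t, heatKernel (x, s) = ∫ τ in Ioc 0 t, heatKernel (x, t - τ) := by
  rw [← intervalIntegral.integral_of_le ht.le, ← intervalIntegral.integral_of_le ht.le,
    intervalIntegral.integral_comp_sub_left (fun s => heatKernel (x, s)) t, sub_self, sub_zero]

lemma integrableOn_heatKernel_reflect {x : R3} (hx : x ≠ 0) {t : ℝ} (ht : 0 < t) :
    IntegrableOn (fun τ => heatKernel (x, t - τ)) (Ioc 0 t) := by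
  have h1 : IntervalIntegrable (fun s => heatKernel (x, s)) volume 0 t :=
    (intervalIntegrable_iff_integrableOn_Ioc_of_le ht.le).2
      ((integrableOn_heatKernel_time hx).mono_set Ioc_subset_Ioi_self)
  have := (h1.comp_sub_left t).symm
  simp only [sub_zero, sub_self] at this
  exact (intervalIntegrable_iff_integrableOn_Ioc_of_le ht.le).1 this

/-- The Newtonian potential is `∫_0^∞ G(x-γ(t),s) ds`; subtracting it from the heat potential leaves
the effect of the motion of the source, and a tail. -/
lemma remainder_ae_eq (hγ : Continuous γ) {t : ℝ} (ht : 0 < t) :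
    ∀ᵐ x : R3, remainder γ x t =
      (∫ τ in Ioc 0 t, (heatKernel (x - γ τ, t - τ) - heatKernel (x - γ t, t - τ))) -
        ∫ s in Ioi t, heatKernel (x - γ t, s) := by
  have hne : ∀ᵐ x : R3, x ≠ γ t := by simp [ae_iff]
  filter_upwards [hne, (integrable_heatKernel_curve_time hγ t).prod_right_ae] with x hx hint
  have hx' : x - γ t ≠ 0 := sub_ne_zero.2 hx
  have h1 := integrableOn_heatKernel_time hx'
  rw [remainder, ← integral_heatKernel_time hx', heatPotential_eq_setIntegral γ x le_rfl,
    ← Ioc_union_Ioi_eq_Ioi ht.le, setIntegral_union (Ioc_disjoint_Ioi le_rfl) measurableSet_Ioi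
      (h1.mono_set Ioc_subset_Ioi_self) (h1.mono_set (Ioi_subset_Ioi ht.le)),
    integral_sub hint (integrableOn_heatKernel_reflect hx' ht), integral_heatKernel_Ioc_reflect ht]
  ring

lemma aestronglyMeasurable_remainder (hγ : Continuous γ) (t : ℝ) :
    AEStronglyMeasurable (fun x => remainder γ x t) volume := by
  refine (integrable_heatPotential hγ t).aestronglyMeasurable.sub ?_
  exact Measurable.aestronglyMeasurable (by fun_prop)

/-- The Hölder bound on the curve turns the Lipschitz estimate for the heat kernel into a gain of
`(t-τ)^{α-1/2}`. -/
lemma enorm_remainder_le (hγ : Continuous γ) {α A t : ℝ} (ht : 0 < t) (hA : 0 ≤ A)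
    (hH : ∀ τ ∈ Ioc 0 t, ‖γ t - γ τ‖ ≤ A * (t - τ) ^ α) :
    ∀ᵐ x : R3, ‖remainder γ x t‖ₑ ≤
      (∫⁻ τ in Ioc 0 t, ENNReal.ofReal (2 ^ (3 / 2 : ℝ) * A * (t - τ) ^ (α - 1 / 2) *
        heatKernel (x - γ τ, 2 * (t - τ)))) +
      (∫⁻ τ in Ioc 0 t, ENNReal.ofReal (2 ^ (3 / 2 : ℝ) * A * (t - τ) ^ (α - 1 / 2) *
        heatKernel (x - γ t, 2 * (t - τ)))) +
      ∫⁻ s in Ioi t, ENNReal.ofReal (1 * heatKernel (x - γ t, s)) := by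
  filter_upwards [remainder_ae_eq hγ ht] with x hx
  rw [hx]
  refine enorm_sub_le.trans (add_le_add ?_ ?_)
  · refine (enorm_integral_le_lintegral_enorm _).trans ?_
    have hm : Measurable fun τ => ENNReal.ofReal (2 ^ (3 / 2 : ℝ) * A * (t - τ) ^ (α - 1 / 2) *
        heatKernel (x - γ τ, 2 * (t - τ))) := by
      have := hγ.measurable
      have h1 : Measurable fun τ : ℝ => heatKernel (x - γ τ, 2 * (t - τ)) :=
        measurable_heatKernel.comp (by fun_prop)
      fun_prop
    rw [← lintegral_add_left hm]
    refine lintegral_mono_ae ?_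
    filter_upwards [ae_lt_of_Ioc t, ae_restrict_mem measurableSet_Ioc] with τ hτ hτ'
    have hs : 0 < t - τ := sub_pos.2 hτ
    have hc : 0 ≤ 2 ^ (3 / 2 : ℝ) * A * (t - τ) ^ (α - 1 / 2) := by positivity
    rw [← ENNReal.ofReal_add (mul_nonneg hc (heatKernel_nonneg _))
      (mul_nonneg hc (heatKernel_nonneg _)), ← mul_add, Real.enorm_eq_ofReal_abs]
    refine ENNReal.ofReal_le_ofReal ((abs_heatKernel_sub_le hs _ _).trans ?_)
    refine mul_le_mul_of_nonneg_right ?_ (add_nonneg (heatKernel_nonneg _) (heatKernel_nonneg _))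
    rw [mul_assoc]
    refine mul_le_mul_of_nonneg_left ?_ (by positivity)
    rw [sub_sub_sub_cancel_left, show α - 1 / 2 = -(1 / 2) + α by ring, Real.rpow_add hs,
      mul_left_comm]
    exact mul_le_mul_of_nonneg_left (hH τ hτ') (by positivity)
  · refine (enorm_integral_le_lintegral_enorm _).trans (le_of_eq ?_)
    refine lintegral_congr fun s => ?_
    rw [one_mul, Real.enorm_eq_ofReal_abs, abs_of_nonneg (heatKernel_nonneg _)]

/-- The powers of time in the bounds of `enorm_remainder_le` are integrable near `τ = t` exactly for
`q (2 - 2α) < 3`, and at infinity in the tail exactly for `q > 3`. -/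
lemma eLpNorm_remainder_le (hγ : Continuous γ) {α q T : ℝ} (hα : 1 / 2 ≤ α)
    (hq : 3 < q) (hqα : q * (2 - 2 * α) < 3) (hT : 0 < T) {A : ℝ} (hA : 0 < A)
    (hH : ∀ t ∈ Ioc 0 T, ∀ τ ∈ Ioc 0 t, ‖γ t - γ τ‖ ≤ A * (t - τ) ^ α) :
    ∃ C : ℝ, 0 < C ∧ ∀ t ∈ Ioc 0 T,
      eLpNorm (fun x => remainder γ x t) (ENNReal.ofReal q) volume ≤
        ENNReal.ofReal (C * t ^ ((3 / q - 1) / 2)) := by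
  have hq0 : 0 < q := by linarith
  obtain ⟨c, hc, hK⟩ := exists_lintegral_heatKernel_rpow hq0
  set β : ℝ := -(3 / 2) * (1 - 1 / q) with hβ
  have hβ1 : β < -1 := by
    have : 1 / q < 1 / 3 := one_div_lt_one_div_of_lt (by norm_num) hq
    rw [hβ]; linarith
  have hβα : 0 < α - 1 / 2 + β + 1 := by
    have h1 : 2 - 2 * α < 3 * (1 / q) := by
      rw [mul_one_div, lt_div_iff₀ hq0]; linarith
    rw [hβ]; linarith
  have hβe : β + 1 = (3 / q - 1) / 2 := by rw [hβ]; ring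
  -- `C₁` bounds each of the two near-field terms, `C₂` the tail.
  set D : ℝ := 2 ^ (3 / 2 : ℝ) * A * c * 2 ^ β with hD
  have hD0 : 0 < D := by positivity
  set C₁ : ℝ := D * (T ^ (α - 1 / 2) / (α - 1 / 2 + β + 1)) with hC₁
  have hC₁0 : 0 < C₁ := by positivity
  set C₂ : ℝ := c / (-(β + 1)) with hC₂
  have hC₂0 : 0 < C₂ := div_pos hc (by linarith)
  refine ⟨C₁ + C₁ + C₂, by positivity, fun t ht => ?_⟩
  have ht0 := ht.1
  have hq1 : 1 < q := by linarith
  have hpos : ∀ᵐ τ ∂(volume.restrict (Ioc 0 t)),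
      0 < 2 ^ (3 / 2 : ℝ) * A * (t - τ) ^ (α - 1 / 2) ∧ 0 < 2 * (t - τ) := by
    filter_upwards [ae_lt_of_Ioc t] with τ hτ
    have := sub_pos.2 hτ
    constructor <;> positivity
  have hw : ∫⁻ τ in Ioc 0 t, ENNReal.ofReal (2 ^ (3 / 2 : ℝ) * A * (t - τ) ^ (α - 1 / 2) *
      (c * (2 * (t - τ)) ^ β)) ≤ ENNReal.ofReal (C₁ * t ^ (β + 1)) := by
    have e : ∫⁻ τ in Ioc 0 t, ENNReal.ofReal (2 ^ (3 / 2 : ℝ) * A * (t - τ) ^ (α - 1 / 2) *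
      (c * (2 * (t - τ)) ^ β)) =
        ∫⁻ τ in Ioc 0 t, ENNReal.ofReal (D * (t - τ) ^ (α - 1 / 2 + β)) := by
      refine lintegral_congr_ae ?_
      filter_upwards [ae_lt_of_Ioc t] with τ hτ
      have hs := sub_pos.2 hτ
      rw [Real.mul_rpow two_pos.le hs.le, Real.rpow_add hs, hD]
      ring_nf
    rw [e, lintegral_Ioc_sub_rpow hD0.le (by linarith) ht0]
    refine ENNReal.ofReal_le_ofReal ?_
    have e2 : t ^ (α - 1 / 2 + β + 1) = t ^ (α - 1 / 2) * t ^ (β + 1) := by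
      rw [← Real.rpow_add ht0]; ring_nf
    have e3 : t ^ (α - 1 / 2) ≤ T ^ (α - 1 / 2) :=
      Real.rpow_le_rpow ht0.le ht.2 (sub_nonneg.2 hα)
    rw [e2, hC₁, mul_assoc D]
    refine mul_le_mul_of_nonneg_left ?_ hD0.le
    rw [div_mul_eq_mul_div]
    gcongr
  have hγm := hγ.measurable
  have b1 := (eLpNorm_lintegral_heatKernel_le (a := γ) hγm
    (m := fun τ => 2 ^ (3 / 2 : ℝ) * A * (t - τ) ^ (α - 1 / 2)) (by fun_prop)
    (σ := fun τ => 2 * (t - τ)) (by fun_prop) hpos hq1 hc hK).trans hw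
  have b2 := (eLpNorm_lintegral_heatKernel_le (a := fun _ => γ t) measurable_const
    (m := fun τ => 2 ^ (3 / 2 : ℝ) * A * (t - τ) ^ (α - 1 / 2)) (by fun_prop)
    (σ := fun τ => 2 * (t - τ)) (by fun_prop) hpos hq1 hc hK).trans hw
  have b3 : eLpNorm (fun x : R3 => ∫⁻ s in Ioi t, ENNReal.ofReal (1 * heatKernel (x - γ t, s)))
      (ENNReal.ofReal q) volume ≤ ENNReal.ofReal (C₂ * t ^ (β + 1)) := by
    refine (eLpNorm_lintegral_heatKernel_le (a := fun _ => γ t) measurable_const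
      (m := fun _ => 1) measurable_const (σ := fun s => s) measurable_id ?_ hq1 hc hK).trans ?_
    · filter_upwards [ae_restrict_mem measurableSet_Ioi] with s hs
      exact ⟨one_pos, ht0.trans hs⟩
    · simp only [one_mul]
      rw [lintegral_Ioi_rpow hc.le hβ1 ht0]
      refine ENNReal.ofReal_le_ofReal (le_of_eq ?_)
      rw [hC₂]; ring
  have hm : ∀ (ν : Measure ℝ) [SFinite ν] (a : ℝ → R3) (m σ : ℝ → ℝ), Measurable a → Measurable m →
      Measurable σ → AEStronglyMeasurable (fun x : R3 => ∫⁻ τ,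
        ENNReal.ofReal (m τ * heatKernel (x - a τ, σ τ)) ∂ν) volume := by
    intro ν _ a m σ ha hm hσ
    refine (Measurable.lintegral_prod_right
      (f := fun x τ => ENNReal.ofReal (m τ * heatKernel (x - a τ, σ τ))) ?_).aestronglyMeasurable
    have h1 : Measurable fun z : R3 × ℝ => heatKernel (z.1 - a z.2, σ z.2) :=
      measurable_heatKernel.comp (by fun_prop)
    unfold Function.uncurry
    fun_prop
  have m1 := hm (volume.restrict (Ioc 0 t)) γ
    (fun τ => 2 ^ (3 / 2 : ℝ) * A * (t - τ) ^ (α - 1 / 2)) (fun τ => 2 * (t - τ)) hγm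
    (by fun_prop) (by fun_prop)
  have m2 := hm (volume.restrict (Ioc 0 t)) (fun _ => γ t)
    (fun τ => 2 ^ (3 / 2 : ℝ) * A * (t - τ) ^ (α - 1 / 2)) (fun τ => 2 * (t - τ))
    measurable_const (by fun_prop) (by fun_prop)
  have m3 := hm (volume.restrict (Ioi t)) (fun _ => γ t) (fun _ => 1) (fun s => s)
    measurable_const measurable_const measurable_id
  have hq1' : 1 ≤ ENNReal.ofReal q := by
    rw [← ENNReal.ofReal_one]; exact ENNReal.ofReal_le_ofReal hq1.le
  have htp : 0 ≤ t ^ (β + 1) := by positivity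
  calc eLpNorm (fun x => remainder γ x t) (ENNReal.ofReal q) volume
      ≤ _ := eLpNorm_mono_enorm_ae (by
        simpa only [enorm_eq_self, Pi.add_apply] using enorm_remainder_le hγ ht0 hA.le (hH t ht))
    _ ≤ _ := (eLpNorm_add_le (m1.add m2) m3 hq1').trans
        (add_le_add ((eLpNorm_add_le m1 m2 hq1').trans (add_le_add b1 b2)) b3)
    _ = ENNReal.ofReal ((C₁ + C₁ + C₂) * t ^ ((3 / q - 1) / 2)) := by
        rw [← hβe, ← ENNReal.ofReal_add (by positivity) (by positivity),
          ← ENNReal.ofReal_add (by positivity) (by positivity)]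
        ring_nf

end Remainder

/-! ### Extension of the curve to negative times -/

section Extension

open scoped Topology

/-- The curve `γ` with its values at negative times replaced by `γ 0`, so that continuity on `[0,∞)`
becomes continuity on `ℝ`. -/
def extendCurve (γ : ℝ → R3) (t : ℝ) : R3 := γ (max t 0)

variable {γ : ℝ → R3}

lemma extendCurve_of_nonneg {t : ℝ} (ht : 0 ≤ t) : extendCurve γ t = γ t := by
  rw [extendCurve, max_eq_left ht]

lemma IsHolderCurve.continuousOn {α : ℝ} (hα : 0 < α) (hγ : IsHolderCurve α γ) :
    ContinuousOn γ (Ici 0) := by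
  intro t ht
  have ht0 : 0 ≤ t := ht
  obtain ⟨K, hK⟩ := hγ (t + 1) (by linarith)
  have hlim : Filter.Tendsto (fun s => K * |s - t| ^ α) (𝓝[Ici 0] t) (𝓝 0) := by
    have hc : Continuous fun s : ℝ => K * |s - t| ^ α :=
      continuous_const.mul (Continuous.rpow_const (by fun_prop) fun _ => Or.inr hα.le)
    have := hc.tendsto t
    simp only [sub_self, abs_zero, Real.zero_rpow hα.ne', mul_zero] at this
    exact this.mono_left nhdsWithin_le_nhds
  refine tendsto_iff_norm_sub_tendsto_zero.2 (squeeze_zero' (Filter.Eventually.of_forall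
    fun s => norm_nonneg _) ?_ hlim)
  filter_upwards [self_mem_nhdsWithin, nhdsWithin_le_nhds (gt_mem_nhds (lt_add_one t))]
    with s hs hs'
  exact hK t ⟨ht0, by linarith⟩ s ⟨hs, hs'.le⟩

lemma IsHolderCurve.continuous_extendCurve {α : ℝ} (hα : 0 < α) (hγ : IsHolderCurve α γ) :
    Continuous (extendCurve γ) :=
  (hγ.continuousOn hα).comp_continuous (f := fun t => max t 0) (by fun_prop)
    fun t => mem_Ici.2 (le_max_right t 0)

lemma offCurve_extendCurve : offCurve (extendCurve γ) = offCurve γ := by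
  have h : {p : R3 × ℝ | ∃ t : ℝ, 0 < t ∧ p = (extendCurve γ t, t)} =
      {p | ∃ t : ℝ, 0 < t ∧ p = (γ t, t)} := by
    ext p
    refine exists_congr fun t => and_congr_right fun ht => ?_
    rw [extendCurve_of_nonneg ht.le]
  rw [offCurve, offCurve, h]

lemma duhamelFourier_extendCurve {t : ℝ} (ht : 0 ≤ t) :
    duhamelFourier (extendCurve γ) t = duhamelFourier γ t := by
  ext ξ
  refine intervalIntegral.integral_congr fun τ hτ => ?_
  rw [uIcc_of_le ht] at hτ
  simp only [extendCurve_of_nonneg hτ.1]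

lemma IsMildSolution.of_extendCurve {u : R3 → ℝ → ℝ} (h : IsMildSolution (extendCurve γ) u) :
    IsMildSolution γ u where
  fourier t ht := duhamelFourier_extendCurve (γ := γ) ht ▸ h.fourier t ht
  bounded := by
    obtain ⟨M, hM⟩ := h.bounded
    exact ⟨M, fun t ht => duhamelFourier_extendCurve (γ := γ) ht ▸ hM t ht⟩
  weaklyContinuous := h.weaklyContinuous

lemma IsDistributionalSolution.of_extendCurve {u : R3 → ℝ → ℝ}
    (h : IsDistributionalSolution (extendCurve γ) u) : IsDistributionalSolution γ u where
  locallyIntegrable := h.locallyIntegrable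
  weak φ hφ hc := by
    rw [h.weak φ hφ hc]
    refine setIntegral_congr_fun measurableSet_Ioi fun t ht => ?_
    simp only [extendCurve_of_nonneg (le_of_lt ht)]

end Extension

end

theorem theorem4p1 (α : ℝ) (hα : α ∈ Ioc (1 / 2 : ℝ) 1) (γ : ℝ → R3)
    (hγ : IsHolderCurve α γ) :
    ∃ u : R3 → ℝ → ℝ,
      -- `u` solves `∂ₜ u - Δ u = δ_{γ(t)}` with zero initial datum
      IsMildSolution γ u ∧ IsDistributionalSolution γ u ∧
      -- `u` is smooth off the curve and solves the heat equation there pointwise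
      ContDiffOn ℝ ∞ (fun p : R3 × ℝ => u p.1 p.2) (offCurve γ) ∧
      (∀ x t, (x, t) ∈ offCurve γ → deriv (fun s => u x s) t = Δ (fun y => u y t) x) ∧
      -- decomposition; for `α = 1` the range of `q` is `(3, ∞)`
      ∃ ω₀ : R3 → ℝ → ℝ,
        (∀ x t, (x, t) ∈ offCurve γ → u x t = ω₀ x t + 1 / (4 * Real.pi * ‖x - γ t‖)) ∧
        ∀ q : ℝ, 3 < q → q * (2 - 2 * α) < 3 → ∀ T : ℝ, 0 < T →
          ∃ C : ℝ, 0 < C ∧ ∀ t ∈ Ioc 0 T,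
            MemLp (fun x => ω₀ x t) (ENNReal.ofReal q) volume ∧
            eLpNorm (fun x => ω₀ x t) (ENNReal.ofReal q) volume ≤
              ENNReal.ofReal (C * t ^ ((3 / q - 1) / 2)) := by
  have hα0 : 0 < α := by linarith [hα.1]
  have hc : Continuous (extendCurve γ) := hγ.continuous_extendCurve hα0
  refine ⟨heatPotential (extendCurve γ), (isMildSolution_heatPotential hc).of_extendCurve,
    (isDistributionalSolution_heatPotential hc).of_extendCurve, ?_, ?_,
    remainder (extendCurve γ), ?_, ?_⟩
  · rw [← offCurve_extendCurve]
    exact fun p hp => (contDiffAt_heatPotential hc hp).contDiffWithinAt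
  · rw [← offCurve_extendCurve]
    exact fun x t hp => heatEquation_heatPotential hc hp
  · intro x t hp
    have ht : 0 < t := hp.1
    rw [remainder, extendCurve_of_nonneg ht.le, sub_add_cancel]
  · intro q hq hqα T hT
    obtain ⟨K, hK⟩ := hγ T hT
    have hA : 0 < max K 1 := lt_max_of_lt_right one_pos
    obtain ⟨C, hC, hle⟩ := eLpNorm_remainder_le hc hα.1.le hq hqα hT hA fun t ht τ hτ => by
      rw [extendCurve_of_nonneg ht.1.le, extendCurve_of_nonneg hτ.1.le]
      have hts : 0 ≤ t - τ := sub_nonneg.2 hτ.2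
      refine (hK τ ⟨hτ.1.le, hτ.2.trans ht.2⟩ t ⟨ht.1.le, ht.2⟩).trans ?_
      rw [abs_of_nonneg hts]
      gcongr
      exact le_max_left _ _
    exact ⟨C, hC, fun t ht => ⟨⟨aestronglyMeasurable_remainder hc t,
      (hle t ht).trans_lt ENNReal.ofReal_lt_top⟩, hle t ht⟩⟩
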